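/- Let $2\le k<n$ be integers and $c\in[0,1]$. Each of $n$ bidders demands one of $k$ items and receives a private signal; the signals $s_1,\dots,s_n$ are i.i.d. with a density $f$, have finite second moment, and are concentrated on an interval $(0,\bar s)$ with $0<\bar s\le\infty$ on which $f>0$. An item is worth $v_i(\mathbf s)=(1-c)s_i+\frac cn\sum_{j=1}^n s_j$ to bidder $i$. For $\delta\in[0,1]$, in the $\delta$-mixed auction bidders submit bids $b_1,\dots,b_n\ge 0$; with $Y_{k+1}(\mathbf b)$ the $(k+1)$-th highest bid, bidder $i$ wins an item if and only if $b_i>Y_{k+1}(\mathbf b)$, a winner pays $\delta b_i+(1-\delta)Y_{k+1}(\mathbf b)$, and a loser pays nothing. An equilibrium is a symmetric Bayes--Nash equilibrium $b_i=\beta(s_i)$ with $\beta:(0,\bar s)\to[0,\infty)$ strictly increasing: for every bidder and every signal $s\in(0,\bar s)$, the bid $\beta(s)$ maximizes the expected surplus over all bids $a\ge0$ when all opponents bid according to $\beta$. Let $u_i^{\delta}(\mathbf s)$ denote the ex-post surplus of bidder $i$ (value minus payment for a winner, $0$ for a loser) in an equilibrium of the $\delta$-mixed auction, and call $i$ a winner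 at $\mathbf s$ if $s_i>Y_{k+1}(\mathbf s)$. **Theorem.** Suppose that $f$ is log-concave, i.e. $\log f$ is concave on $(0,\bar s)$. For every $\delta\in[0,1-c]$ the $\delta$-mixed auction has an equilibrium, and for all equilibria: 1. The $(1-c)$-mixed auction dominates in pairwise differences every $\delta$-mixed auction with $0\le\delta<1-c$: almost surely, $|u_i^{1-c}(\mathbf s)-u_j^{1-c}(\mathbf s)|\le|u_i^{\delta}(\mathbf s)-u_j^{\delta}(\mathbf s)|$ for all winners $i,j$, with strict inequality for at least one pair of winners. 2. Pairwise differences decrease monotonically in $\delta$ on $[0,1-c]$: almost surely, for all winners $i,j$, the map $\delta\mapsto|u_i^{\delta}(\mathbf s)-u_j^{\delta}(\mathbf s)|$ is non-increasing on $[0,1-c]$, whichever equilibrium is selected for each $\delta$. -/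

import Mathlib

open MeasureTheory

noncomputable section

namespace MixedAuction

/-- The `m`-th highest entry of the vector `x` (for `1 ≤ m ≤ n`): the largest real `y` such that
at least `m` entries of `x` are greater than or equal to `y`. -/
def kthHighest {n : ℕ} (m : ℕ) (x : Fin n → ℝ) : ℝ :=
  sSup {y : ℝ | m ≤ (Finset.univ.filter fun j : Fin n => y ≤ x j).card}

/-- The open support `(0, sbar)` of the signals; `sbar = ⊤` is the unbounded case. -/
def openSupport (sbar : EReal) : Set ℝ := {s : ℝ | 0 < s ∧ (s : EReal) < sbar}

/-- The value of an item to bidder `i` at the signal profile `s`; `c` is the proportion of the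
common value. -/
def value {n : ℕ} (c : ℝ) (s : Fin n → ℝ) (i : Fin n) : ℝ :=
  (1 - c) * s i + c / n * ∑ j, s j

/-- Entry `i` of `b` (a profile of bids or of signals) beats the `(k+1)`-th highest entry. -/
def Wins {n : ℕ} (k : ℕ) (b : Fin n → ℝ) (i : Fin n) : Prop :=
  kthHighest (k + 1) b < b i

open Classical in
/-- The payment of bidder `i` in the `k`-unit `δ`-mixed auction at the bid profile `b`. -/
def price {n : ℕ} (k : ℕ) (δ : ℝ) (b : Fin n → ℝ) (i : Fin n) : ℝ :=
  if Wins k b i then δ * b i + (1 - δ) * kthHighest (k + 1) b else 0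

open Classical in
/-- The surplus of bidder `i` in the `k`-unit `δ`-mixed auction, at signals `s` and bids `b`. -/
def payoff {n : ℕ} (k : ℕ) (c δ : ℝ) (s b : Fin n → ℝ) (i : Fin n) : ℝ :=
  (if Wins k b i then value c s i else 0) - price k δ b i

/-- The expected surplus of bidder `i` with signal `x` who bids `a`, when the opponents' signals
are independent with law `μ` and the opponents bid according to the strategy `β`. (Coordinate
`i` of the integration variable is overwritten.) -/
def interimUtility {n : ℕ} (μ : Measure ℝ) (k : ℕ) (c δ : ℝ) (β : ℝ → ℝ) (i : Fin n)
    (x a : ℝ) : ℝ :=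
  ∫ s : Fin n → ℝ, payoff k c δ (Function.update s i x)
    (Function.update (fun j => β (s j)) i a) i ∂(Measure.pi fun _ : Fin n => μ)

/-- `β` is a symmetric Bayes-Nash equilibrium in increasing strategies of the `k`-unit `δ`-mixed
auction with `n` bidders, signal law `μ` and open support of signals `(0, sbar)`. Bids are
nonnegative. -/
structure IsEquilibrium (n k : ℕ) (μ : Measure ℝ) (sbar : EReal) (c δ : ℝ) (β : ℝ → ℝ) :
    Prop where
  nonneg : ∀ x ∈ openSupport sbar, 0 ≤ β x
  strictMonoOn : StrictMonoOn β (openSupport sbar)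
  optimal : ∀ i : Fin n, ∀ x ∈ openSupport sbar, ∀ a : ℝ, 0 ≤ a →
    interimUtility μ k c δ β i x a ≤ interimUtility μ k c δ β i x (β x)

/-- The ex-post utilities in the `k`-unit `δ`-mixed auction when all bidders use `β`. -/
def exPostUtility {n : ℕ} (k : ℕ) (c δ : ℝ) (β : ℝ → ℝ) (s : Fin n → ℝ) (i : Fin n) : ℝ :=
  payoff k c δ s (fun j => β (s j)) i

/-- The outcome `u` dominates the outcome `u'` in pairwise differences among winners: almost
surely, all absolute pairwise differences among the winners (the bidders with the `k` highest
signals) are weakly smaller under `u`, and at least one is strictly smaller. -/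
def DominatesInPairwiseDifferences {n : ℕ} (μ : Measure ℝ) (k : ℕ)
    (u u' : (Fin n → ℝ) → Fin n → ℝ) : Prop :=
  ∀ᵐ s ∂(Measure.pi fun _ : Fin n => μ),
    (∀ i j : Fin n, Wins k s i → Wins k s j → |u s i - u s j| ≤ |u' s i - u' s j|) ∧
    ∃ i j : Fin n, Wins k s i ∧ Wins k s j ∧ |u s i - u s j| < |u' s i - u' s j|

end MixedAuction

end

/-!
The surplus of two winners `i` and `j` differs by `(1 - c) (s i - s j) - δ (β (s i) - β (s j))`: the
common value and the uniform part of the price cancel (`exPostUtility_sub`). The theorem therefore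
asks how the spread `δ (β x - β y)` of the discriminatory part of the price depends on `δ`. For
`x > y` it turns out to be strictly increasing in `δ`, and at most `δ (x - y) ≤ (1 - c) (x - y)`, so
that the differences stay nonnegative and shrink (`IsBidProblem.abs_spread_lt`).

*Equilibria.* A bidder wins iff the own bid exceeds the `k`-th highest opposing bid. Up to null sets
the profile space splits according to which opponent `j` holds the `k`-th highest opposing signal
`t` and which `k - 1` opponents are above; given the ranking and `t`, the other signals are independent.
Integration over the pieces (`integral_rankEvent`) expresses the interim utility through the weight
`g = F ^ (n - 1 - k) (1 - F) ^ (k - 1) f`, a multiple of the density of `t`, and the tie value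
`V t`, the expected value of an item to a bidder with signal `t` given that the `k`-th highest opposing
signal is `t` as well. With `G` the primitive of `g`, an increasing `β ≥ 0` is an equilibrium iff
`δ β G + (1 - δ) ∫ β g = ∫ V g` at every signal (`isEquilibrium_iff`). Necessity needs no regularity
of `β`: incentive compatibility bounds the increments of the defect of the equation by
`(x - z) (G x - G z)`, so its derivative vanishes. For `δ > 0` it follows that `β` is
differentiable with `δ β' = (V - β) g / G`; for `δ = 0` the spread is zero whatever `β` is.

*Log-concavity.* It passes from `f` to `F`, `1 - F` and `g`. Therefore `g / G` is nonincreasing, and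
the mean residual life and its mirror image are monotone, which makes `V` grow at rate at most one.

*Comparison.* A bounded function `u` with `u' + γ u g / G > 0` is positive, because `u G ^ γ`
increases from `0` (`IsBidProblem.comparison_pos`). Applied to suitable differences, this gives
`β < V`, the monotone decrease of `β` in `δ` (`IsBidProblem.bid_lt_bid`), hence the increase of
`δ β' = (V - β) g / G` in `δ`, and `β' ≤ 1` (`IsBidProblem.value_sub_bid_le`).
-/

/-! ### Log-concave functions -/

namespace MixedAuction

/-- Log-concavity of a nonnegative function on the line, in multiplicative form: moving two points
towards each other by the same distance does not decrease the product of the values. Zeros are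
allowed, so that a density and its distribution functions can be treated on all of `ℝ`. -/
structure MulLogConcave (f : ℝ → ℝ) : Prop where
  nonneg : ∀ x, 0 ≤ f x
  mul_le : ∀ u v d, 0 ≤ d → u + d ≤ v → f u * f v ≤ f (u + d) * f (v - d)

namespace MulLogConcave

variable {f g : ℝ → ℝ}

theorem mul (hf : MulLogConcave f) (hg : MulLogConcave g) :
    MulLogConcave fun x => f x * g x where
  nonneg x := mul_nonneg (hf.nonneg x) (hg.nonneg x)
  mul_le u v d hd h := by
    have := mul_le_mul (hf.mul_le u v d hd h) (hg.mul_le u v d hd h)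
      (mul_nonneg (hg.nonneg _) (hg.nonneg _)) (mul_nonneg (hf.nonneg _) (hf.nonneg _))
    linarith

theorem pow (hf : MulLogConcave f) (m : ℕ) : MulLogConcave fun x => f x ^ m where
  nonneg x := pow_nonneg (hf.nonneg x) m
  mul_le u v d hd h := by
    rw [← mul_pow, ← mul_pow]
    exact pow_le_pow_left₀ (mul_nonneg (hf.nonneg _) (hf.nonneg _)) (hf.mul_le u v d hd h) m

theorem comp_neg (hf : MulLogConcave f) : MulLogConcave fun x => f (-x) where
  nonneg x := hf.nonneg _
  mul_le u v d hd h := by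
    have := hf.mul_le (-v) (-u) d hd (by linarith)
    rw [show -(u + d) = -u - d by ring, show -(v - d) = -v + d by ring]
    linarith

theorem of_concaveOn_log {I : Set ℝ} (hpos : ∀ x ∈ I, 0 < f x)
    (hf : ConcaveOn ℝ I fun x => Real.log (f x)) : MulLogConcave (I.indicator f) where
  nonneg x := Set.indicator_nonneg (fun x hx => (hpos x hx).le) x
  mul_le u v d hd h := by
    have hnn := fun x => Set.indicator_nonneg (fun x hx => (hpos x hx).le) x (s := I) (f := f)
    by_cases hu : u ∈ I
    swap
    · rw [Set.indicator_of_notMem hu, zero_mul]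
      exact mul_nonneg (hnn _) (hnn _)
    by_cases hv : v ∈ I
    swap
    · rw [Set.indicator_of_notMem hv, mul_zero]
      exact mul_nonneg (hnn _) (hnn _)
    rcases hd.eq_or_lt with rfl | hd
    · simp
    have huv : 0 < v - u := by linarith
    have ha : 0 ≤ d / (v - u) := by positivity
    have hb : 0 ≤ (v - u - d) / (v - u) := div_nonneg (by linarith) huv.le
    have hab : (v - u - d) / (v - u) + d / (v - u) = 1 := by field_simp; ring
    have e1 : ((v - u - d) / (v - u)) • u + (d / (v - u)) • v = u + d := by
      simp only [smul_eq_mul]; field_simp; ring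
    have e2 : (d / (v - u)) • u + ((v - u - d) / (v - u)) • v = v - d := by
      simp only [smul_eq_mul]; field_simp; ring
    have m1 : u + d ∈ I := e1 ▸ hf.1 hu hv hb ha hab
    have m2 : v - d ∈ I := e2 ▸ hf.1 hu hv ha hb (by rw [add_comm]; exact hab)
    have c1 := hf.2 hu hv hb ha hab
    have c2 := hf.2 hu hv ha hb (by rw [add_comm]; exact hab)
    rw [e1] at c1
    rw [e2] at c2
    simp only [smul_eq_mul] at c1 c2
    rw [Set.indicator_of_mem hu, Set.indicator_of_mem hv, Set.indicator_of_mem m1,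
      Set.indicator_of_mem m2, ← Real.log_le_log_iff (mul_pos (hpos _ hu) (hpos _ hv))
        (mul_pos (hpos _ m1) (hpos _ m2)), Real.log_mul (hpos _ hu).ne' (hpos _ hv).ne',
      Real.log_mul (hpos _ m1).ne' (hpos _ m2).ne']
    have : (v - u - d) / (v - u) = 1 - d / (v - u) := by linarith
    rw [this] at c1 c2
    nlinarith

theorem setIntegral_Iic_eq (f : ℝ → ℝ) (x : ℝ) :
    ∫ y in Set.Iic x, f y = ∫ t in Set.Ioi (0 : ℝ), f (x - t) := by
  have h1 := integral_comp_neg_Iic 0 fun t => f (x - t)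
  rw [neg_zero] at h1
  rw [← h1]
  have := (measurePreserving_add_right (volume : Measure ℝ) x).setIntegral_preimage_emb
    (MeasurableEquiv.addRight x).measurableEmbedding f (Set.Iic x)
  rw [← this]
  simp [sub_eq_add_neg, add_comm]

theorem integrableOn_Ioi_comp_sub (x : ℝ) (hf : IntegrableOn f (Set.Iic x)) :
    IntegrableOn (fun t => f (x - t)) (Set.Ioi (0 : ℝ)) := by
  have := (Measure.measurePreserving_sub_left (volume : Measure ℝ) x).integrableOn_comp_preimage
    (MeasurableEquiv.subLeft x).measurableEmbedding (f := f) (s := Set.Iio x)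
  have h2 := this.2 (hf.mono_set Set.Iio_subset_Iic_self)
  simpa [Function.comp_def] using h2

/-- The ratio of a log-concave function to its primitive is nonincreasing (case `r = 0`). The shift
by `r ≥ 0` is what makes the primitive log-concave in turn. -/
theorem setIntegral_Iic_mul_le (hf : MulLogConcave f) (hi : ∀ x, IntegrableOn f (Set.Iic x))
    {x y : ℝ} (hxy : x ≤ y) (r : ℝ) (hr : 0 ≤ r) :
    (∫ t in Set.Iic x, f t) * f (y + r) ≤ f (x + r) * ∫ t in Set.Iic y, f t := by
  rw [setIntegral_Iic_eq, setIntegral_Iic_eq, ← integral_mul_const, ← integral_const_mul]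
  refine setIntegral_mono_on ((integrableOn_Ioi_comp_sub x (hi x)).mul_const _)
    ((integrableOn_Ioi_comp_sub y (hi y)).const_mul _) measurableSet_Ioi fun t ht => ?_
  have ht : (0 : ℝ) < t := ht
  have := hf.mul_le (x - t) (y + r) (t + r) (by linarith) (by linarith)
  rwa [show x - t + (t + r) = x + r by ring, show y + r - (t + r) = y - t by ring] at this

theorem setIntegral_Iic (hf : MulLogConcave f) (hi : ∀ x, IntegrableOn f (Set.Iic x)) :
    MulLogConcave fun x => ∫ t in Set.Iic x, f t where
  nonneg x := setIntegral_nonneg measurableSet_Iic fun t _ => hf.nonneg t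
  mul_le u v d hd h := by
    -- after splitting off the increments over length `d`, the claim is the ratio bound integrated
    -- over the shift `r`
    have split : ∀ w, ∫ t in Set.Iic (w + d), f t =
        (∫ t in Set.Iic w, f t) + ∫ r in (0 : ℝ)..d, f (w + r) := by
      intro w
      rw [intervalIntegral.integral_comp_add_left, add_zero,
        ← intervalIntegral.integral_Iic_sub_Iic (hi _) (hi _)]
      ring
    have hii : ∀ w, IntervalIntegrable (fun r => f (w + r)) volume 0 d := fun w => by
      have : IntervalIntegrable f volume w (w + d) :=
        intervalIntegrable_iff.2 ((hi (max w (w + d))).mono_set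
          fun t ht => ht.2)
      simpa using this.comp_add_left w
    have e1 := split u
    have e2 := split (v - d)
    rw [sub_add_cancel] at e2
    simp only [e1, e2]
    have : (∫ t in Set.Iic u, f t) * (∫ r in (0 : ℝ)..d, f (v - d + r)) ≤
        (∫ r in (0 : ℝ)..d, f (u + r)) * ∫ t in Set.Iic (v - d), f t := by
      rw [← intervalIntegral.integral_const_mul, ← intervalIntegral.integral_mul_const]
      refine intervalIntegral.integral_mono_on hd ((hii _).const_mul _) ((hii _).mul_const _)
        fun r hr => ?_
      exact hf.setIntegral_Iic_mul_le hi (by linarith) r hr.1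
    linarith

theorem setIntegral_Ioi (hf : MulLogConcave f) (hi : Integrable f) :
    MulLogConcave fun x => ∫ t in Set.Ioi x, f t := by
  have h := (hf.comp_neg.setIntegral_Iic fun x => hi.comp_neg.integrableOn).comp_neg
  simpa only [integral_comp_neg_Iic, neg_neg] using h

end MulLogConcave
end MixedAuction

/-! ### Conditional means above and below a threshold -/

namespace MixedAuction

/-- The mean of the law `μ` conditional on exceeding `t` (`0` if this event is null). -/
noncomputable def aboveMean (μ : Measure ℝ) (t : ℝ) : ℝ :=
  (∫ y in Set.Ioi t, y ∂μ) / μ.real (Set.Ioi t)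

/-- The mean of the law `μ` conditional on lying below `t` (`0` if this event is null). -/
noncomputable def belowMean (μ : Measure ℝ) (t : ℝ) : ℝ :=
  (∫ y in Set.Iio t, y ∂μ) / μ.real (Set.Iio t)

variable {μ : Measure ℝ}

/-- Reflection reduces statements about `belowMean` to statements about `aboveMean`. -/
theorem belowMean_eq (t : ℝ) : belowMean μ t = -aboveMean (μ.map Neg.neg) (-t) := by
  have hm : MeasurableEmbedding (Neg.neg : ℝ → ℝ) := (MeasurableEquiv.neg ℝ).measurableEmbedding
  have hs : (Neg.neg : ℝ → ℝ) ⁻¹' Set.Ioi (-t) = Set.Iio t := by ext; simp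
  rw [belowMean, aboveMean, hm.setIntegral_map, measureReal_def, measureReal_def,
    hm.map_apply, hs, integral_neg, neg_div, neg_neg]

theorem map_neg_real_Ioi (t : ℝ) : (μ.map Neg.neg).real (Set.Ioi t) = μ.real (Set.Iio (-t)) := by
  rw [map_measureReal_apply measurable_neg measurableSet_Ioi]
  congr 1
  ext; simp

theorem integrable_map_neg (hi : Integrable (fun x : ℝ => x) μ) :
    Integrable (fun x : ℝ => x) (μ.map Neg.neg) := by
  have hm : MeasurableEmbedding (Neg.neg : ℝ → ℝ) := (MeasurableEquiv.neg ℝ).measurableEmbedding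
  rw [hm.integrable_map_iff]
  exact hi.neg

variable [IsProbabilityMeasure μ]

theorem aboveMean_mono (hi : Integrable (fun x : ℝ => x) μ) {t t' : ℝ} (h : t ≤ t')
    (ht' : 0 < μ.real (Set.Ioi t')) : aboveMean μ t ≤ aboveMean μ t' := by
  have hsub : Set.Ioi t' ⊆ Set.Ioi t := Set.Ioi_subset_Ioi h
  have ht : 0 < μ.real (Set.Ioi t) := ht'.trans_le (measureReal_mono hsub)
  have hd : Disjoint (Set.Ioc t t') (Set.Ioi t') := Set.Ioc_disjoint_Ioi le_rfl
  have hu : Set.Ioc t t' ∪ Set.Ioi t' = Set.Ioi t := Set.Ioc_union_Ioi_eq_Ioi h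
  have e1 : ∫ y in Set.Ioi t, y ∂μ = (∫ y in Set.Ioc t t', y ∂μ) + ∫ y in Set.Ioi t', y ∂μ := by
    rw [← hu, setIntegral_union hd measurableSet_Ioi hi.integrableOn hi.integrableOn]
  have e2 : μ.real (Set.Ioi t) = μ.real (Set.Ioc t t') + μ.real (Set.Ioi t') := by
    rw [← hu, measureReal_union hd measurableSet_Ioi]
  have b1 : ∫ y in Set.Ioc t t', y ∂μ ≤ t' * μ.real (Set.Ioc t t') := by
    have := setIntegral_mono_on hi.integrableOn (integrableOn_const (C := t') (μ := μ)
      (s := Set.Ioc t t')) measurableSet_Ioc fun y hy => hy.2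
    rwa [setIntegral_const, smul_eq_mul, mul_comm] at this
  have b2 : t' * μ.real (Set.Ioi t') ≤ ∫ y in Set.Ioi t', y ∂μ := by
    have := setIntegral_mono_on (integrableOn_const (C := t') (μ := μ)
      (s := Set.Ioi t')) hi.integrableOn measurableSet_Ioi fun y hy => le_of_lt hy
    rwa [setIntegral_const, smul_eq_mul, mul_comm] at this
  have b3 : 0 ≤ μ.real (Set.Ioc t t') := measureReal_nonneg
  rw [aboveMean, aboveMean, div_le_div_iff₀ ht ht', e1, e2]
  nlinarith [mul_le_mul_of_nonneg_right b1 ht'.le, mul_le_mul_of_nonneg_right b2 b3]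

/-- The mean excess over `t` is the normalized integral of the survival function beyond `t`. -/
theorem aboveMean_sub_self (hi : Integrable (fun x : ℝ => x) μ) {t : ℝ}
    (ht : 0 < μ.real (Set.Ioi t)) :
    aboveMean μ t - t =
      (∫ r in Set.Ioi (0 : ℝ), μ.real (Set.Ioi (t + r))) / μ.real (Set.Ioi t) := by
  have h0 : ∫ y in Set.Ioi t, (y - t) ∂μ = ∫ r in Set.Ioi (0 : ℝ), μ.real (Set.Ioi (t + r)) := by
    have := (((hi.sub (integrable_const t)).integrableOn
      (s := Set.Ioi t)).integral_eq_integral_meas_lt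
      ((ae_restrict_iff' measurableSet_Ioi).2 (Filter.Eventually.of_forall fun y hy =>
        sub_nonneg.2 (le_of_lt hy))))
    simp only [Pi.sub_apply] at this
    rw [this]
    refine setIntegral_congr_fun measurableSet_Ioi fun r hr => ?_
    have hr : (0 : ℝ) < r := hr
    show (μ.restrict (Set.Ioi t)).real {a | r < a - t} = _
    rw [measureReal_restrict_apply (measurableSet_lt measurable_const (by fun_prop))]
    congr 1
    ext y
    simp only [Set.mem_inter_iff, Set.mem_ofPred_eq, Set.mem_Ioi]
    constructor
    · rintro ⟨h, -⟩; linarith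
    · intro h; constructor <;> linarith
  rw [← h0, integral_sub hi.integrableOn (integrableOn_const (C := t) (μ := μ)),
    setIntegral_const, smul_eq_mul, aboveMean]
  field_simp

theorem integrableOn_measureReal_Ioi (hi : Integrable (fun x : ℝ => x) μ) (t : ℝ) :
    IntegrableOn (fun r => μ.real (Set.Ioi (t + r))) (Set.Ioi (0 : ℝ)) := by
  have hi' : Integrable (fun x : ℝ => max (x - t) 0) μ :=
    (hi.sub (integrable_const t)).pos_part
  have h0 : 0 ≤ᵐ[μ] fun x : ℝ => max (x - t) 0 :=
    Filter.Eventually.of_forall fun x => le_max_right _ _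
  have hl := lintegral_eq_lintegral_meas_lt μ h0 hi'.1.aemeasurable
  have hanti : Antitone fun r => μ.real (Set.Ioi (t + r)) := fun a b hab =>
    measureReal_mono (Set.Ioi_subset_Ioi (by linarith))
  refine ⟨hanti.measurable.aestronglyMeasurable, ?_⟩
  rw [hasFiniteIntegral_iff_enorm]
  have : ∫⁻ r in Set.Ioi (0 : ℝ), ‖μ.real (Set.Ioi (t + r))‖ₑ =
      ∫⁻ r in Set.Ioi (0 : ℝ), μ {a | r < max (a - t) 0} := by
    refine setLIntegral_congr_fun measurableSet_Ioi fun r hr => ?_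
    have hr : (0 : ℝ) < r := hr
    have hs : {a | r < max (a - t) 0} = Set.Ioi (t + r) := by
      ext y
      simp only [Set.mem_ofPred_eq, Set.mem_Ioi, lt_max_iff]
      constructor
      · rintro (h | h) <;> linarith
      · intro h; left; linarith
    simp only [hs]
    rw [Real.enorm_of_nonneg measureReal_nonneg, ofReal_measureReal]
  rw [this, ← hl]
  exact hi'.lintegral_lt_top

/-- For a log-concave survival function the mean residual life is nonincreasing. -/
theorem aboveMean_sub_anti (hi : Integrable (fun x : ℝ => x) μ)
    (hlc : MulLogConcave fun t => μ.real (Set.Ioi t)) {t t' : ℝ} (h : t ≤ t')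
    (ht' : 0 < μ.real (Set.Ioi t')) : aboveMean μ t' - t' ≤ aboveMean μ t - t := by
  have ht : 0 < μ.real (Set.Ioi t) := ht'.trans_le (measureReal_mono (Set.Ioi_subset_Ioi h))
  rw [aboveMean_sub_self hi ht, aboveMean_sub_self hi ht', div_le_div_iff₀ ht' ht,
    ← integral_mul_const, ← integral_mul_const]
  refine setIntegral_mono_on ((integrableOn_measureReal_Ioi hi t').mul_const _)
    ((integrableOn_measureReal_Ioi hi t).mul_const _) measurableSet_Ioi fun r hr => ?_
  have hr : (0 : ℝ) < r := hr
  have := hlc.mul_le t (t' + r) r hr.le (by linarith)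
  rw [show t' + r - r = t' by ring] at this
  linarith

theorem belowMean_mono (hi : Integrable (fun x : ℝ => x) μ) {t t' : ℝ} (h : t ≤ t')
    (ht : 0 < μ.real (Set.Iio t)) : belowMean μ t ≤ belowMean μ t' := by
  have : IsProbabilityMeasure (μ.map Neg.neg) := Measure.isProbabilityMeasure_map (by fun_prop)
  rw [belowMean_eq, belowMean_eq, neg_le_neg_iff]
  refine aboveMean_mono (integrable_map_neg hi) (by linarith) ?_
  rwa [map_neg_real_Ioi, neg_neg]

/-- For a log-concave distribution function the mean shortfall below `t` is nondecreasing in `t`. -/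
theorem sub_belowMean_mono (hi : Integrable (fun x : ℝ => x) μ)
    (hlc : MulLogConcave fun t => μ.real (Set.Iio t)) {t t' : ℝ} (h : t ≤ t')
    (ht : 0 < μ.real (Set.Iio t)) : t - belowMean μ t ≤ t' - belowMean μ t' := by
  have : IsProbabilityMeasure (μ.map Neg.neg) := Measure.isProbabilityMeasure_map (by fun_prop)
  rw [belowMean_eq, belowMean_eq]
  have := aboveMean_sub_anti (μ := μ.map Neg.neg) (t := -t') (t' := -t) (integrable_map_neg hi)
    (by simpa only [map_neg_real_Ioi] using hlc.comp_neg) (by linarith)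
    (by rwa [map_neg_real_Ioi, neg_neg])
  linarith

end MixedAuction

/-! ### The integrated first-order condition for bids -/

namespace MixedAuction
open Filter Topology

/-- The primitive of `g` vanishing at `0`. -/
noncomputable def cumul (g : ℝ → ℝ) (x : ℝ) : ℝ := ∫ t in (0 : ℝ)..x, g t

/-- The data of the one-dimensional bidding problem on an interval `I = (0, sbar)`: `g` is, up to a
factor, the density of the `k`-th highest opposing signal, and `V x` is the value of an item to a
bidder with signal `x` who ties with that signal. Log-concavity enters through `cumul_mul_le` (the
ratio `g / ∫ g` is nonincreasing) and `value_sub_le` (the value grows at most as fast as the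
signal). -/
structure IsBidProblem (I : Set ℝ) (g V : ℝ → ℝ) : Prop where
  isOpen : IsOpen I
  pos : ∀ x ∈ I, 0 < x
  Ioc_subset : ∀ x ∈ I, Set.Ioc 0 x ⊆ I
  continuousOn : ContinuousOn g I
  weight_pos : ∀ x ∈ I, 0 < g x
  integrable : ∀ x ∈ I, IntervalIntegrable g volume 0 x
  cumul_mul_le : ∀ x ∈ I, ∀ y ∈ I, x ≤ y → cumul g x * g y ≤ g x * cumul g y
  value_nonneg : ∀ x ∈ I, 0 ≤ V x
  value_strictMono : StrictMonoOn V I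
  value_sub_le : ∀ x ∈ I, ∀ y ∈ I, x ≤ y → V y - V x ≤ y - x

/-- The first-order condition for the bid function `β`, integrated over the signals below `x`. It
equates the expected payment of a bidder with signal `x` to the tie value integrated over the
opposing signals below `x`, and it is meaningful without any regularity of `β`: for `δ > 0` it
amounts to the differential equation `δ β' G = (V - β) g` with `G = cumul g`, and for `δ = 0` to
`β = V` almost everywhere. -/
def SolvesBidEquation (I : Set ℝ) (g V : ℝ → ℝ) (δ : ℝ) (β : ℝ → ℝ) : Prop :=
  ∀ x ∈ I, δ * β x * cumul g x + (1 - δ) * cumul (fun t => β t * g t) x =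
    cumul (fun t => V t * g t) x

theorem nonneg_of_deriv_nonneg {Φ Φ' : ℝ → ℝ} {b : ℝ} (hb : 0 < b)
    (hd : ∀ x ∈ Set.Ioc 0 b, HasDerivAt Φ (Φ' x) x) (hΦ : ∀ x ∈ Set.Ioo 0 b, 0 ≤ Φ' x)
    (h0 : Tendsto Φ (𝓝[>] 0) (𝓝 0)) : 0 ≤ Φ b := by
  have hmono : MonotoneOn Φ (Set.Ioc 0 b) :=
    monotoneOn_of_deriv_nonneg (convex_Ioc 0 b)
      (fun x hx => (hd x hx).continuousAt.continuousWithinAt)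
      (fun x hx => by
        rw [interior_Ioc] at hx
        exact (hd x ⟨hx.1, hx.2.le⟩).differentiableAt.differentiableWithinAt)
      (fun x hx => by
        rw [interior_Ioc] at hx
        rw [(hd x ⟨hx.1, hx.2.le⟩).deriv]
        exact hΦ x hx)
  refine le_of_tendsto h0 ?_
  filter_upwards [Ioc_mem_nhdsGT hb] with z hz
  exact hmono hz ⟨hb, le_rfl⟩ hz.2

theorem pos_of_deriv_pos {Φ Φ' : ℝ → ℝ} {b : ℝ} (hb : 0 < b)
    (hd : ∀ x ∈ Set.Ioc 0 b, HasDerivAt Φ (Φ' x) x) (hΦ : ∀ x ∈ Set.Ioo 0 b, 0 < Φ' x)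
    (h0 : Tendsto Φ (𝓝[>] 0) (𝓝 0)) : 0 < Φ b := by
  have h1 : 0 ≤ Φ (b / 2) := nonneg_of_deriv_nonneg (by linarith)
    (fun x hx => hd x ⟨hx.1, by linarith [hx.2]⟩)
    (fun x hx => (hΦ x ⟨hx.1, by linarith [hx.2]⟩).le) h0
  have hmono : StrictMonoOn Φ (Set.Ioc 0 b) :=
    strictMonoOn_of_deriv_pos (convex_Ioc 0 b)
      (fun x hx => (hd x hx).continuousAt.continuousWithinAt)
      (fun x hx => by
        rw [interior_Ioc] at hx
        rw [(hd x ⟨hx.1, hx.2.le⟩).deriv]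
        exact hΦ x hx)
  exact h1.trans_lt (hmono ⟨by linarith, by linarith⟩ ⟨hb, le_rfl⟩ (by linarith))

theorem eq_zero_of_deriv_eq_zero {Φ : ℝ → ℝ} {b : ℝ} (hb : 0 < b)
    (hd : ∀ x ∈ Set.Ioc 0 b, HasDerivAt Φ 0 x) (h0 : Tendsto Φ (𝓝[>] 0) (𝓝 0)) : Φ b = 0 := by
  refine le_antisymm ?_ (nonneg_of_deriv_nonneg hb hd (fun _ _ => le_rfl) h0)
  have := nonneg_of_deriv_nonneg hb (Φ := fun x => -Φ x) (Φ' := fun _ => 0)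
    (fun x hx => by simpa using (hd x hx).fun_neg) (fun _ _ => le_rfl) (by simpa using h0.neg)
  linarith

theorem cumul_mono {ψ : ℝ → ℝ} {x y : ℝ} (h0 : 0 ≤ x) (hxy : x ≤ y)
    (hψ : IntervalIntegrable ψ volume 0 y) (hnn : ∀ t ∈ Set.Ioc 0 y, 0 ≤ ψ t) :
    cumul ψ x ≤ cumul ψ y := by
  refine intervalIntegral.integral_mono_interval le_rfl h0 hxy ?_ hψ
  exact (ae_restrict_iff' measurableSet_Ioc).2 (Eventually.of_forall hnn)

theorem cumul_le_cumul {ψ φ : ℝ → ℝ} {x : ℝ} (h0 : 0 ≤ x)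
    (hψ : IntervalIntegrable ψ volume 0 x) (hφ : IntervalIntegrable φ volume 0 x)
    (h : ∀ t ∈ Set.Ioc 0 x, ψ t ≤ φ t) :
    cumul ψ x ≤ cumul φ x := by
  rw [cumul, cumul, intervalIntegral.integral_of_le h0, intervalIntegral.integral_of_le h0]
  exact setIntegral_mono_on hψ.1 hφ.1 measurableSet_Ioc h

namespace IsBidProblem

variable {I : Set ℝ} {g V : ℝ → ℝ}

theorem exists_gt (H : IsBidProblem I g V) {x : ℝ} (hx : x ∈ I) : ∃ y ∈ I, x < y := by
  have h1 : I ∈ 𝓝[>] x := mem_nhdsWithin_of_mem_nhds (H.isOpen.mem_nhds hx)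
  obtain ⟨y, hy, hxy⟩ := Filter.nonempty_of_mem (inter_mem h1
    (self_mem_nhdsWithin (s := Set.Ioi x)))
  exact ⟨y, hy, hxy⟩

theorem stronglyMeasurableAtFilter (H : IsBidProblem I g V) {ψ : ℝ → ℝ} (hψ : ContinuousOn ψ I)
    {x : ℝ} (hx : x ∈ I) : StronglyMeasurableAtFilter ψ (𝓝 x) volume :=
  hψ.stronglyMeasurableAtFilter H.isOpen x hx

theorem hasDerivAt_cumul (H : IsBidProblem I g V) {ψ : ℝ → ℝ} (hψ : ContinuousOn ψ I)
    {x : ℝ} (hx : x ∈ I) (hi : IntervalIntegrable ψ volume 0 x) :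
    HasDerivAt (cumul ψ) (ψ x) x :=
  intervalIntegral.integral_hasDerivAt_right hi (H.stronglyMeasurableAtFilter hψ hx)
    (hψ.continuousAt (H.isOpen.mem_nhds hx))

theorem continuousAt_cumul (H : IsBidProblem I g V) {ψ : ℝ → ℝ}
    (hi : ∀ x ∈ I, IntervalIntegrable ψ volume 0 x) {x : ℝ} (hx : x ∈ I) :
    ContinuousAt (cumul ψ) x := by
  obtain ⟨y, hy, hxy⟩ := H.exists_gt hx
  have hx0 := H.pos x hx
  have h := intervalIntegral.continuousOn_primitive_interval (a := 0) (b := y) (f := ψ)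
    (μ := volume) (by
      rw [Set.uIcc_of_le (hx0.trans hxy).le, integrableOn_Icc_iff_integrableOn_Ioc]
      exact (hi y hy).1)
  refine h.continuousAt ?_
  rw [Set.uIcc_of_le (hx0.trans hxy).le]
  exact Icc_mem_nhds hx0 hxy

theorem tendsto_cumul_zero (H : IsBidProblem I g V) (hI : I.Nonempty) {ψ : ℝ → ℝ}
    (hi : ∀ x ∈ I, IntervalIntegrable ψ volume 0 x) :
    Tendsto (cumul ψ) (𝓝[>] 0) (𝓝 0) := by
  obtain ⟨y, hy⟩ := hI
  have hy0 := H.pos y hy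
  have h := intervalIntegral.continuousOn_primitive_interval (a := 0) (b := y) (f := ψ)
    (μ := volume) (by
      rw [Set.uIcc_of_le hy0.le, integrableOn_Icc_iff_integrableOn_Ioc]
      exact (hi y hy).1)
  rw [Set.uIcc_of_le hy0.le] at h
  have h2 := (h 0 ⟨le_rfl, hy0.le⟩).mono_left
    (nhdsWithin_mono 0 (Set.Ioc_subset_Icc_self (a := (0 : ℝ)) (b := y)))
  rw [nhdsWithin_Ioc_eq_nhdsGT hy0] at h2
  simp only [intervalIntegral.integral_same] at h2
  exact h2

theorem integrable_monotone_mul (H : IsBidProblem I g V) {ψ : ℝ → ℝ} (hψ : MonotoneOn ψ I)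
    (h0 : ∀ x ∈ I, 0 ≤ ψ x) {x : ℝ} (hx : x ∈ I) :
    IntervalIntegrable (fun t => ψ t * g t) volume 0 x := by
  have hx0 := H.pos x hx
  have hg := H.integrable x hx
  rw [intervalIntegrable_iff_integrableOn_Ioc_of_le hx0.le] at hg ⊢
  refine Integrable.bdd_mul (c := ψ x) hg ?_ ?_
  · exact (aemeasurable_restrict_of_monotoneOn measurableSet_Ioc
      (hψ.mono (H.Ioc_subset x hx))).aestronglyMeasurable
  · refine (ae_restrict_iff' measurableSet_Ioc).2 (Eventually.of_forall fun t ht => ?_)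
    have htI := H.Ioc_subset x hx ht
    rw [Real.norm_of_nonneg (h0 t htI)]
    exact hψ htI hx ht.2

theorem cumul_pos (H : IsBidProblem I g V) {x : ℝ} (hx : x ∈ I) : 0 < cumul g x :=
  intervalIntegral.intervalIntegral_pos_of_pos_on (H.integrable x hx)
    (fun t ht => H.weight_pos t (H.Ioc_subset x hx ⟨ht.1, ht.2.le⟩)) (H.pos x hx)

theorem hasDerivAt_cumul_weight (H : IsBidProblem I g V) {x : ℝ} (hx : x ∈ I) :
    HasDerivAt (cumul g) (g x) x :=
  H.hasDerivAt_cumul H.continuousOn hx (H.integrable x hx)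

theorem value_continuousOn (H : IsBidProblem I g V) : ContinuousOn V I := by
  have : LipschitzOnWith 1 V I := by
    refine LipschitzOnWith.of_dist_le_mul fun x hx y hy => ?_
    rw [NNReal.coe_one, one_mul, Real.dist_eq, Real.dist_eq]
    rcases le_total x y with h | h
    · rw [abs_sub_comm, abs_sub_comm x, abs_of_nonneg (sub_nonneg.2 h),
        abs_of_nonneg (sub_nonneg.2 (H.value_strictMono.monotoneOn hx hy h))]
      exact H.value_sub_le x hx y hy h
    · rw [abs_of_nonneg (sub_nonneg.2 h),
        abs_of_nonneg (sub_nonneg.2 (H.value_strictMono.monotoneOn hy hx h))]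
      exact H.value_sub_le y hy x hx h
  exact this.continuousOn

theorem tendsto_bdd_mul_cumul_rpow (H : IsBidProblem I g V) {u : ℝ → ℝ} {γ C b : ℝ} (hγ : 0 < γ)
    (hb : b ∈ I) (hu : ∀ x ∈ Set.Ioc 0 b, |u x| ≤ C) :
    Tendsto (fun x => u x * cumul g x ^ γ) (𝓝[>] 0) (𝓝 0) := by
  have h1 : Tendsto (fun x => cumul g x ^ γ) (𝓝[>] 0) (𝓝 0) := by
    have := (H.tendsto_cumul_zero ⟨b, hb⟩ H.integrable).rpow_const (p := γ) (Or.inr hγ.le)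
    rwa [Real.zero_rpow hγ.ne'] at this
  have h2 := h1.abs.const_mul C
  rw [abs_zero, mul_zero] at h2
  refine squeeze_zero_norm' ?_ h2
  filter_upwards [Ioc_mem_nhdsGT (H.pos b hb)] with x hx
  rw [norm_mul, Real.norm_eq_abs, Real.norm_eq_abs]
  exact mul_le_mul_of_nonneg_right (hu x hx) (abs_nonneg _)

theorem hasDerivAt_mul_cumul_rpow (H : IsBidProblem I g V) {u : ℝ → ℝ} {u' γ x : ℝ}
    (hx : x ∈ I) (hu : HasDerivAt u u' x) :
    HasDerivAt (fun x => u x * cumul g x ^ γ)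
      (cumul g x ^ γ * (u' + γ * u x * g x / cumul g x)) x := by
  have hG := H.cumul_pos hx
  have := hu.fun_mul ((H.hasDerivAt_cumul_weight hx).rpow_const (p := γ) (Or.inl hG.ne'))
  refine this.congr_deriv ?_
  rw [Real.rpow_sub_one hG.ne']
  field_simp

/-- Comparison principle: a bounded function `u` with `u' + γ u g / G > 0` is positive, because
`u G ^ γ` is increasing and tends to `0` at `0`. -/
theorem comparison_pos (H : IsBidProblem I g V) {u u' : ℝ → ℝ} {γ C b : ℝ} (hγ : 0 < γ)
    (hb : b ∈ I) (hu : ∀ x ∈ Set.Ioc 0 b, |u x| ≤ C)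
    (hd : ∀ x ∈ Set.Ioc 0 b, HasDerivAt u (u' x) x)
    (h : ∀ x ∈ Set.Ioo 0 b, 0 < u' x + γ * u x * g x / cumul g x) : 0 < u b := by
  have hI := H.Ioc_subset b hb
  have := pos_of_deriv_pos (H.pos b hb)
    (fun x hx => H.hasDerivAt_mul_cumul_rpow (γ := γ) (hI hx) (hd x hx))
    (fun x hx => mul_pos (Real.rpow_pos_of_pos (H.cumul_pos (hI ⟨hx.1, hx.2.le⟩)) γ) (h x hx))
    (H.tendsto_bdd_mul_cumul_rpow hγ hb hu)
  exact pos_of_mul_pos_left this (Real.rpow_nonneg (H.cumul_pos hb).le _)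

theorem comparison_nonneg (H : IsBidProblem I g V) {u u' : ℝ → ℝ} {γ C b : ℝ} (hγ : 0 < γ)
    (hb : b ∈ I) (hu : ∀ x ∈ Set.Ioc 0 b, |u x| ≤ C)
    (hd : ∀ x ∈ Set.Ioc 0 b, HasDerivAt u (u' x) x)
    (h : ∀ x ∈ Set.Ioo 0 b, 0 ≤ u' x + γ * u x * g x / cumul g x) : 0 ≤ u b := by
  have hI := H.Ioc_subset b hb
  have := nonneg_of_deriv_nonneg (H.pos b hb)
    (fun x hx => H.hasDerivAt_mul_cumul_rpow (γ := γ) (hI hx) (hd x hx))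
    (fun x hx => mul_nonneg (Real.rpow_pos_of_pos (H.cumul_pos (hI ⟨hx.1, hx.2.le⟩)) γ).le (h x hx))
    (H.tendsto_bdd_mul_cumul_rpow hγ hb hu)
  exact nonneg_of_mul_nonneg_left this (Real.rpow_pos_of_pos (H.cumul_pos hb) _)

/-- The integrated condition first yields continuity of `β`, then differentiability. -/
theorem hasDerivAt_of_solves (H : IsBidProblem I g V) {δ : ℝ} (hδ : 0 < δ) {β : ℝ → ℝ}
    (hβ : MonotoneOn β I) (h0 : ∀ x ∈ I, 0 ≤ β x) (hs : SolvesBidEquation I g V δ β)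
    {x : ℝ} (hx : x ∈ I) :
    HasDerivAt β ((V x - β x) * g x / (δ * cumul g x)) x := by
  have hβi := fun x hx => H.integrable_monotone_mul hβ h0 (x := x) hx
  have hVi := fun x hx => H.integrable_monotone_mul H.value_strictMono.monotoneOn
    H.value_nonneg (x := x) hx
  have heq : ∀ y ∈ I, (cumul (fun t => V t * g t) y - (1 - δ) * cumul (fun t => β t * g t) y) /
      (δ * cumul g y) = β y := by
    intro y hy
    rw [← hs y hy]
    have := (H.cumul_pos hy).ne'
    field_simp
    ring
  have hcont : ContinuousOn β I := by
    refine ContinuousOn.congr (fun y hy => ContinuousAt.continuousWithinAt ?_)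
      fun y hy => (heq y hy).symm
    exact ((H.continuousAt_cumul hVi hy).sub ((H.continuousAt_cumul hβi hy).const_mul _)).div
      ((H.continuousAt_cumul H.integrable hy).const_mul _)
      (mul_pos hδ (H.cumul_pos hy)).ne'
  have hG := H.cumul_pos hx
  have hd := ((H.hasDerivAt_cumul (H.value_continuousOn.mul H.continuousOn) hx (hVi x hx)).sub
    ((H.hasDerivAt_cumul (hcont.mul H.continuousOn) hx (hβi x hx)).const_mul (1 - δ))).div
      ((H.hasDerivAt_cumul_weight hx).const_mul δ) (mul_pos hδ hG).ne'
  have hd2 := hd.congr_of_eventuallyEq (f₁ := β) (by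
    filter_upwards [H.isOpen.mem_nhds hx] with y hy
    exact (heq y hy).symm)
  refine hd2.congr_deriv ?_
  have hsx : δ * β x * cumul g x + (1 - δ) * cumul (β * g) x = cumul (V * g) x := hs x hx
  simp only [Pi.sub_apply, Pi.mul_apply]
  rw [← hsx]
  field_simp
  ring

end IsBidProblem
end MixedAuction

/-! ### Comparison of bids and existence -/

namespace MixedAuction
open Filter Topology
namespace IsBidProblem

variable {I : Set ℝ} {g V : ℝ → ℝ}

/-- Bid shading: bids stay below the tie value. Since `V` need not be differentiable, the comparison
is made with the constant `V x`. -/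
theorem lt_value_of_hasDerivAt (H : IsBidProblem I g V) {δ : ℝ} (hδ : 0 < δ) {β : ℝ → ℝ}
    (hd : ∀ x ∈ I, HasDerivAt β ((V x - β x) * g x / (δ * cumul g x)) x)
    {C : ℝ} {x : ℝ} (hx : x ∈ I) (hC : ∀ t ∈ Set.Ioc 0 x, |β t| ≤ C) : β x < V x := by
  have hI := H.Ioc_subset x hx
  have := H.comparison_pos (u := fun t => V x - β t)
    (u' := fun t => -((V t - β t) * g t / (δ * cumul g t))) (γ := 1 / δ) (C := |V x| + C)
    (by positivity) hx
    (fun t ht => (abs_sub _ _).trans (by linarith [hC t ht]))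
    (fun t ht => by simpa using (hd t (hI ht)).const_sub (V x))
    (fun t ht => by
      have htI := hI ⟨ht.1, ht.2.le⟩
      have hG := H.cumul_pos htI
      have hg := H.weight_pos t htI
      have hV := H.value_strictMono htI hx ht.2
      have e : -((V t - β t) * g t / (δ * cumul g t)) + 1 / δ * (V x - β t) * g t / cumul g t =
          (V x - V t) * g t / (δ * cumul g t) := by field_simp; ring
      rw [e]
      exact div_pos (mul_pos (sub_pos.2 hV) hg) (mul_pos hδ hG))
  linarith

theorem abs_le_of_monotone {β : ℝ → ℝ} (hβ : MonotoneOn β I) (h0 : ∀ x ∈ I, 0 ≤ β x) {x : ℝ}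
    (hI : Set.Ioc 0 x ⊆ I) (hx : x ∈ I) : ∀ t ∈ Set.Ioc 0 x, |β t| ≤ β x := fun t ht => by
  rw [abs_of_nonneg (h0 t (hI ht))]
  exact hβ (hI ht) hx ht.2

/-- A larger weight on the own bid leads to lower bids. -/
theorem bid_lt_bid (H : IsBidProblem I g V) {δ₁ δ₂ : ℝ} (h1 : 0 < δ₁) (h12 : δ₁ < δ₂)
    {β₁ β₂ : ℝ → ℝ} (hβ₁ : MonotoneOn β₁ I) (h01 : ∀ x ∈ I, 0 ≤ β₁ x)
    (hs₁ : SolvesBidEquation I g V δ₁ β₁) (hβ₂ : MonotoneOn β₂ I) (h02 : ∀ x ∈ I, 0 ≤ β₂ x)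
    (hs₂ : SolvesBidEquation I g V δ₂ β₂) {x : ℝ} (hx : x ∈ I) : β₂ x < β₁ x := by
  have hI := H.Ioc_subset x hx
  have h2 : 0 < δ₂ := h1.trans h12
  have hd₁ := fun t ht => H.hasDerivAt_of_solves h1 hβ₁ h01 hs₁ (x := t) ht
  have hd₂ := fun t ht => H.hasDerivAt_of_solves h2 hβ₂ h02 hs₂ (x := t) ht
  have := H.comparison_pos (u := fun t => β₁ t - β₂ t)
    (u' := fun t => (V t - β₁ t) * g t / (δ₁ * cumul g t) - (V t - β₂ t) * g t / (δ₂ * cumul g t))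
    (γ := 1 / δ₁) (C := β₁ x + β₂ x) (by positivity) hx
    (fun t ht => (abs_sub _ _).trans
      (add_le_add (abs_le_of_monotone hβ₁ h01 hI hx t ht) (abs_le_of_monotone hβ₂ h02 hI hx t ht)))
    (fun t ht => (hd₁ t (hI ht)).sub (hd₂ t (hI ht)))
    (fun t ht => by
      have htI := hI ⟨ht.1, ht.2.le⟩
      have hG := H.cumul_pos htI
      have hg := H.weight_pos t htI
      have hlt := H.lt_value_of_hasDerivAt h2 hd₂ htI
        (abs_le_of_monotone hβ₂ h02 (H.Ioc_subset t htI) htI)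
      have e : (V t - β₁ t) * g t / (δ₁ * cumul g t) - (V t - β₂ t) * g t / (δ₂ * cumul g t) +
          1 / δ₁ * (β₁ t - β₂ t) * g t / cumul g t =
          (V t - β₂ t) * g t * (δ₂ - δ₁) / (δ₁ * δ₂ * cumul g t) := by field_simp; ring
      rw [e]
      exact div_pos (mul_pos (mul_pos (sub_pos.2 hlt) hg) (sub_pos.2 h12))
        (mul_pos (mul_pos h1 h2) hG))
  linarith

/-- In view of the differential equation for `β`, this says `β' ≤ 1`. The bid is compared with the
line of slope `1` through the point at `x` where the slope prescribed by the equation is `1`; it is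
a subsolution because `V` grows at rate at most one and `G / g` is nondecreasing. -/
theorem value_sub_bid_le (H : IsBidProblem I g V) {δ : ℝ} (hδ : 0 < δ) {β : ℝ → ℝ}
    (hβ : MonotoneOn β I) (h0 : ∀ x ∈ I, 0 ≤ β x) (hs : SolvesBidEquation I g V δ β)
    {x : ℝ} (hx : x ∈ I) : (V x - β x) * g x ≤ δ * cumul g x := by
  have hI := H.Ioc_subset x hx
  have hd := fun t ht => H.hasDerivAt_of_solves hδ hβ h0 hs (x := t) ht
  have hgx := H.weight_pos x hx
  have hGx := H.cumul_pos hx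
  set K := V x - x - δ * cumul g x / g x with hK
  have := H.comparison_nonneg (u := fun t => β t - (K + t))
    (u' := fun t => (V t - β t) * g t / (δ * cumul g t) - 1) (γ := 1 / δ)
    (C := β x + (|K| + |x|)) (by positivity) hx
    (fun t ht => by
      refine (abs_sub _ _).trans (add_le_add (abs_le_of_monotone hβ h0 hI hx t ht)
        ((abs_add_le _ _).trans (add_le_add le_rfl ?_)))
      rw [abs_of_pos ht.1]
      exact ht.2.trans (le_abs_self x))
    (fun t ht => (hd t (hI ht)).sub ((hasDerivAt_id t).const_add K))
    (fun t ht => by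
      have htI := hI ⟨ht.1, ht.2.le⟩
      have hG := H.cumul_pos htI
      have hg := H.weight_pos t htI
      have hr := H.cumul_mul_le t htI x hx ht.2.le
      have hV := H.value_sub_le t htI x hx ht.2.le
      have e : (V t - β t) * g t / (δ * cumul g t) - 1 +
          1 / δ * (β t - (K + t)) * g t / cumul g t =
          ((V t - K - t) * g t - δ * cumul g t) / (δ * cumul g t) := by field_simp; ring
      rw [e]
      refine div_nonneg (sub_nonneg.2 ?_) (mul_pos hδ hG).le
      have h1 : δ * cumul g x / g x ≤ V t - K - t := by rw [hK]; linarith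
      have h2 : δ * cumul g t ≤ δ * cumul g x / g x * g t := by
        rw [div_mul_eq_mul_div, le_div_iff₀ hgx]
        nlinarith
      exact h2.trans (mul_le_mul_of_nonneg_right h1 hg.le))
  have h3 : V x - β x ≤ δ * cumul g x / g x := by rw [hK] at this; linarith
  rwa [le_div_iff₀ hgx] at h3

theorem Icc_subset (H : IsBidProblem I g V) {x y : ℝ} (hx : x ∈ I) (hy : y ∈ I) :
    Set.Icc x y ⊆ I := fun _ ht => H.Ioc_subset y hy ⟨(H.pos x hx).trans_le ht.1, ht.2⟩

theorem convex (H : IsBidProblem I g V) : Convex ℝ I :=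
  Set.OrdConnected.convex ⟨fun _ hx _ hy => H.Icc_subset hx hy⟩

theorem bid_sub_le (H : IsBidProblem I g V) {δ : ℝ} (hδ : 0 < δ) {β : ℝ → ℝ}
    (hβ : MonotoneOn β I) (h0 : ∀ x ∈ I, 0 ≤ β x) (hs : SolvesBidEquation I g V δ β)
    {x y : ℝ} (hx : x ∈ I) (hy : y ∈ I) (hxy : x ≤ y) : β y - β x ≤ y - x := by
  have hd := fun t ht => H.hasDerivAt_of_solves hδ hβ h0 hs (x := t) ht
  have hm : MonotoneOn (fun t => t - β t) I :=
    monotoneOn_of_deriv_nonneg H.convex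
      (fun t ht => ((hasDerivAt_id t).sub (hd t ht)).continuousAt.continuousWithinAt)
      (fun t ht => ((hasDerivAt_id t).sub
        (hd t (interior_subset ht))).differentiableAt.differentiableWithinAt)
      (fun t ht => by
        have ht := interior_subset ht
        have := ((hasDerivAt_id t).sub (hd t ht)).deriv
        have e : deriv (fun t => t - β t) t = 1 - (V t - β t) * g t / (δ * cumul g t) := this
        rw [e, sub_nonneg, div_le_one (mul_pos hδ (H.cumul_pos ht))]
        exact H.value_sub_bid_le hδ hβ h0 hs ht)
  have := hm hx hy hxy
  simp only at this
  linarith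

/-- The spread of the own-bid part of the payments grows strictly with `δ`. -/
theorem mul_bid_sub_lt (H : IsBidProblem I g V) {δ₁ δ₂ : ℝ} (h1 : 0 ≤ δ₁) (h12 : δ₁ < δ₂)
    {β₁ β₂ : ℝ → ℝ} (hβ₁ : MonotoneOn β₁ I) (h01 : ∀ x ∈ I, 0 ≤ β₁ x)
    (hs₁ : SolvesBidEquation I g V δ₁ β₁) (hβ₂ : StrictMonoOn β₂ I) (h02 : ∀ x ∈ I, 0 ≤ β₂ x)
    (hs₂ : SolvesBidEquation I g V δ₂ β₂) {x y : ℝ} (hx : x ∈ I) (hy : y ∈ I) (hxy : x < y) :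
    δ₁ * (β₁ y - β₁ x) < δ₂ * (β₂ y - β₂ x) := by
  have h2 : 0 < δ₂ := h1.trans_lt h12
  rcases h1.eq_or_lt with rfl | h1
  · rw [zero_mul]
    exact mul_pos h2 (sub_pos.2 (hβ₂ hx hy hxy))
  have hd₁ := fun t ht => H.hasDerivAt_of_solves h1 hβ₁ h01 hs₁ (x := t) ht
  have hd₂ := fun t ht => H.hasDerivAt_of_solves h2 hβ₂.monotoneOn h02 hs₂ (x := t) ht
  have hd := fun t ht => ((hd₂ t ht).const_mul δ₂).fun_sub ((hd₁ t ht).const_mul δ₁)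
  have hm : StrictMonoOn (fun t => δ₂ * β₂ t - δ₁ * β₁ t) I :=
    strictMonoOn_of_deriv_pos H.convex
      (fun t ht => (hd t ht).continuousAt.continuousWithinAt)
      (fun t ht => by
        have ht := interior_subset ht
        have hG := H.cumul_pos ht
        rw [(hd t ht).deriv]
        have e : δ₂ * ((V t - β₂ t) * g t / (δ₂ * cumul g t)) -
            δ₁ * ((V t - β₁ t) * g t / (δ₁ * cumul g t)) =
            (β₁ t - β₂ t) * g t / cumul g t := by field_simp; ring
        rw [e]
        exact div_pos (mul_pos (sub_pos.2 (H.bid_lt_bid h1 h12 hβ₁ h01 hs₁ hβ₂.monotoneOn h02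
          hs₂ ht)) (H.weight_pos t ht)) hG)
  have := hm hx hy hxy
  simp only at this
  linarith

/-- For `δ > 0` the solution is the average of `V` over `(0, x)` with respect to the distribution
function `(G / G x) ^ (1 / δ)`. As `δ ≤ 1`, the integrand `V γ G ^ (γ - 1)` against `g`, with
`γ = 1 / δ`, is monotone, hence bounded near `0`. -/
theorem exists_solution (H : IsBidProblem I g V) {δ : ℝ} (h0 : 0 ≤ δ) (h1 : δ ≤ 1) :
    ∃ β : ℝ → ℝ, (∀ x ∈ I, 0 ≤ β x) ∧ StrictMonoOn β I ∧ SolvesBidEquation I g V δ β := by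
  rcases h0.eq_or_lt with rfl | hδ
  · exact ⟨V, H.value_nonneg, H.value_strictMono, fun x _ => by simp⟩
  set γ := 1 / δ with hγ
  have hγ1 : 1 ≤ γ := (one_le_div hδ).2 h1
  have hγ0 : 0 < γ := by linarith
  set ψ : ℝ → ℝ := fun t => (V t * (γ * cumul g t ^ (γ - 1))) * g t with hψ
  have hGmono : MonotoneOn (cumul g) I := fun x hx y hy hxy =>
    cumul_mono (H.pos x hx).le hxy (H.integrable y hy)
      fun t ht => (H.weight_pos t (H.Ioc_subset y hy ht)).le
  have hwnn : ∀ x ∈ I, 0 ≤ V x * (γ * cumul g x ^ (γ - 1)) := fun x hx =>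
    mul_nonneg (H.value_nonneg x hx)
      (mul_nonneg hγ0.le (Real.rpow_nonneg (H.cumul_pos hx).le _))
  have hwmono : MonotoneOn (fun t => V t * (γ * cumul g t ^ (γ - 1))) I :=
    H.value_strictMono.monotoneOn.mul
      (fun x hx y hy hxy => mul_le_mul_of_nonneg_left
        (Real.rpow_le_rpow (H.cumul_pos hx).le (hGmono hx hy hxy) (by linarith)) hγ0.le)
      H.value_nonneg
      (fun x hx => mul_nonneg hγ0.le (Real.rpow_nonneg (H.cumul_pos hx).le _))
  have hψi := fun x hx => H.integrable_monotone_mul hwmono hwnn (x := x) hx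
  have hGc : ContinuousOn (cumul g) I := fun x hx =>
    (H.continuousAt_cumul H.integrable hx).continuousWithinAt
  have hψc : ContinuousOn ψ I :=
    (H.value_continuousOn.mul (continuousOn_const.mul
      (hGc.rpow_const fun x hx => Or.inl (H.cumul_pos hx).ne'))).mul H.continuousOn
  set β : ℝ → ℝ := fun x => cumul ψ x / cumul g x ^ γ with hβ
  have hβd : ∀ x ∈ I, HasDerivAt β ((V x - β x) * g x / (δ * cumul g x)) x := by
    intro x hx
    have hG := H.cumul_pos hx
    have hGp := Real.rpow_pos_of_pos hG γ
    have := (H.hasDerivAt_cumul hψc hx (hψi x hx)).fun_div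
      ((H.hasDerivAt_cumul_weight hx).rpow_const (p := γ) (Or.inl hG.ne')) hGp.ne'
    refine this.congr_deriv ?_
    simp only [hψ, hβ, Real.rpow_sub_one hG.ne']
    rw [hγ] at hGp ⊢
    field_simp
  have hβnn : ∀ x ∈ I, 0 ≤ β x := fun x hx => by
    refine div_nonneg ?_ (Real.rpow_nonneg (H.cumul_pos hx).le _)
    rw [cumul, intervalIntegral.integral_of_le (H.pos x hx).le]
    refine setIntegral_nonneg measurableSet_Ioc fun t ht => ?_
    have htI := H.Ioc_subset x hx ht
    exact mul_nonneg (hwnn t htI) (H.weight_pos t htI).le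
  have hβbd : ∀ x ∈ I, β x ≤ γ * V x := fun x hx => by
    have hG := H.cumul_pos hx
    rw [hβ]
    simp only
    rw [div_le_iff₀ (Real.rpow_pos_of_pos hG _)]
    have := cumul_le_cumul (H.pos x hx).le (hψi x hx)
      ((H.integrable x hx).const_mul (V x * (γ * cumul g x ^ (γ - 1))))
      (fun t ht => mul_le_mul_of_nonneg_right
        (hwmono (H.Ioc_subset x hx ht) hx ht.2) (H.weight_pos t (H.Ioc_subset x hx ht)).le)
    refine this.trans_eq ?_
    rw [cumul, intervalIntegral.integral_const_mul, Real.rpow_sub_one hG.ne']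
    change _ * cumul g x = _
    field_simp
  have hβlt : ∀ x ∈ I, β x < V x := fun x hx =>
    H.lt_value_of_hasDerivAt hδ hβd hx (C := γ * V x) fun t ht => by
      have htI := H.Ioc_subset x hx ht
      rw [abs_of_nonneg (hβnn t htI)]
      exact (hβbd t htI).trans
        (mul_le_mul_of_nonneg_left (H.value_strictMono.monotoneOn htI hx ht.2) hγ0.le)
  have hβmono : StrictMonoOn β I :=
    strictMonoOn_of_deriv_pos H.convex
      (fun t ht => (hβd t ht).continuousAt.continuousWithinAt)
      (fun t ht => by
        have ht := interior_subset ht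
        rw [(hβd t ht).deriv]
        exact div_pos (mul_pos (sub_pos.2 (hβlt t ht)) (H.weight_pos t ht))
          (mul_pos hδ (H.cumul_pos ht)))
  refine ⟨β, hβnn, hβmono, fun x hx => ?_⟩
  have hI := H.Ioc_subset x hx
  have hβi := fun x hx => H.integrable_monotone_mul hβmono.monotoneOn hβnn (x := x) hx
  have hVi := fun x hx => H.integrable_monotone_mul H.value_strictMono.monotoneOn
    H.value_nonneg (x := x) hx
  have hβc : ContinuousOn β I := fun t ht => (hβd t ht).continuousAt.continuousWithinAt
  -- the exponent `1` brings the first term into the form of `hasDerivAt_mul_cumul_rpow`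
  have key := eq_zero_of_deriv_eq_zero (H.pos x hx)
    (Φ := fun x => δ * (β x * cumul g x ^ (1 : ℝ)) + (1 - δ) * cumul (fun t => β t * g t) x -
      cumul (fun t => V t * g t) x)
    (fun t ht => by
      have htI := hI ht
      have hG := H.cumul_pos htI
      have := (((H.hasDerivAt_mul_cumul_rpow (γ := 1) htI (hβd t htI)).const_mul δ).fun_add
        ((H.hasDerivAt_cumul (hβc.mul H.continuousOn) htI (hβi t htI)).const_mul (1 - δ))).fun_sub
        (H.hasDerivAt_cumul (H.value_continuousOn.mul H.continuousOn) htI (hVi t htI))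
      refine this.congr_deriv ?_
      simp only [Real.rpow_one, Pi.mul_apply]
      field_simp
      ring)
    (by
      have t1 := H.tendsto_bdd_mul_cumul_rpow one_pos hx
        (abs_le_of_monotone hβmono.monotoneOn hβnn hI hx)
      have t2 := H.tendsto_cumul_zero ⟨x, hx⟩ hβi
      have t3 := H.tendsto_cumul_zero ⟨x, hx⟩ hVi
      simpa using ((t1.const_mul δ).add (t2.const_mul (1 - δ))).sub t3)
  simp only [Real.rpow_one] at key
  linarith

end IsBidProblem
end MixedAuction

/-! ### Winning against a ranking of the opponents -/

namespace MixedAuction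

theorem kthHighest_eq {n m : ℕ} {x : Fin n → ℝ} {y : ℝ}
    (h1 : m ≤ (Finset.univ.filter fun j => y ≤ x j).card)
    (h2 : (Finset.univ.filter fun j => y < x j).card < m) : kthHighest m x = y := by
  refine IsGreatest.csSup_eq ⟨h1, fun z hz => ?_⟩
  by_contra! hlt
  have hz : m ≤ (Finset.univ.filter fun j => z ≤ x j).card := hz
  refine absurd (hz.trans (Finset.card_le_card ?_)) (not_le.2 h2)
  exact Finset.monotone_filter_right _ fun j _ hj => hlt.trans_le hj

theorem le_kthHighest {n m : ℕ} (hm : 0 < m) {x : Fin n → ℝ} {y : ℝ}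
    (h1 : m ≤ (Finset.univ.filter fun j => y ≤ x j).card) : y ≤ kthHighest m x := by
  refine le_csSup ⟨∑ j, |x j|, fun z hz => ?_⟩ h1
  have hz : m ≤ (Finset.univ.filter fun j => z ≤ x j).card := hz
  obtain ⟨j, hj⟩ := Finset.card_pos.1 (hm.trans_le hz)
  exact (Finset.mem_filter.1 hj).2.trans ((le_abs_self _).trans
    (Finset.single_le_sum (f := fun j => |x j|) (fun l _ => abs_nonneg _) (Finset.mem_univ j)))

/-- Among the bidders other than `i`, exactly the members of `A` have signals above that of `j`,
and all the remaining ones have signals below it. -/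
def RankEvent {n : ℕ} (i j : Fin n) (A : Finset (Fin n)) (s : Fin n → ℝ) : Prop :=
  (∀ l ∈ A, s j < s l) ∧ ∀ l, l ∉ A → l ≠ i → l ≠ j → s l < s j

/-- The ways in which the `k`-th highest signal among the bidders other than `i` can arise: a
bidder `j ≠ i` holding it, and the set of the `k - 1` bidders above `j`. -/
def rankings {n : ℕ} (k : ℕ) (i : Fin n) : Finset ((_ : Fin n) × Finset (Fin n)) :=
  (Finset.univ.erase i).sigma fun j => ((Finset.univ.erase i).erase j).powersetCard (k - 1)

theorem mem_rankings {n k : ℕ} {i : Fin n} {p : (_ : Fin n) × Finset (Fin n)} :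
    p ∈ rankings k i ↔ p.1 ≠ i ∧ i ∉ p.2 ∧ p.1 ∉ p.2 ∧ p.2.card = k - 1 := by
  simp only [rankings, Finset.mem_sigma, Finset.mem_erase, Finset.mem_univ, and_true,
    Finset.mem_powersetCard, Finset.subset_iff]
  constructor
  · rintro ⟨h1, h2, h3⟩
    exact ⟨h1, fun h => (h2 h).2 rfl, fun h => (h2 h).1 rfl, h3⟩
  · rintro ⟨h1, h2, h3, h4⟩
    refine ⟨h1, fun l hl => ⟨?_, ?_⟩, h4⟩
    · rintro rfl; exact h3 hl
    · rintro rfl; exact h2 hl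

theorem rankings_nonempty {n k : ℕ} (hk : 2 ≤ k) (hkn : k < n) (i : Fin n) :
    (rankings k i).Nonempty := by
  have : Nontrivial (Fin n) := Fin.nontrivial_iff_two_le.2 (by omega)
  obtain ⟨j, hj⟩ := exists_ne i
  have hc : k - 1 ≤ ((Finset.univ.erase i).erase j).card := by
    rw [Finset.card_erase_of_mem (by simp [hj]), Finset.card_erase_of_mem (by simp)]
    simp only [Finset.card_univ, Fintype.card_fin]
    omega
  obtain ⟨A, hA⟩ := Finset.powersetCard_nonempty.2 hc
  exact ⟨⟨j, A⟩, Finset.mem_sigma.2 ⟨by simp [hj], hA⟩⟩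

/-- Without ties exactly one ranking is realized. -/
theorem exists_unique_ranking {n k : ℕ} (hk : 2 ≤ k) (hkn : k < n) (i : Fin n)
    {s : Fin n → ℝ} (hs : Function.Injective s) :
    ∃ p ∈ rankings k i, RankEvent i p.1 p.2 s ∧
      ∀ p' ∈ rankings k i, RankEvent i p'.1 p'.2 s → p' = p := by
  classical
  -- the number of opponents above is injective, so it takes each of the values `0, …, n - 2`
  set R : Fin n → Finset (Fin n) := fun j => (Finset.univ.erase i).filter fun l => s j < s l
  have hlt : ∀ j ∈ Finset.univ.erase i, ∀ j' ∈ Finset.univ.erase i, s j < s j' →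
      (R j').card < (R j).card := by
    intro j hj j' hj' h
    refine Finset.card_lt_card (Finset.ssubset_iff_subset_ne.2 ⟨?_, fun he => ?_⟩)
    · exact Finset.monotone_filter_right _ fun l _ hl => h.trans hl
    · have : j' ∈ R j := Finset.mem_filter.2 ⟨hj', h⟩
      rw [← he] at this
      exact lt_irrefl _ (Finset.mem_filter.1 this).2
  have hinj : Set.InjOn (fun j => (R j).card) (Finset.univ.erase i : Finset (Fin n)) := by
    intro j hj j' hj' h
    by_contra hne
    rcases lt_or_gt_of_ne (hs.ne hne) with h1 | h1
    · exact (hlt j hj j' hj' h1).ne' h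
    · exact (hlt j' hj' j hj h1).ne h
  have hmaps : Set.MapsTo (fun j => (R j).card) (Finset.univ.erase i : Finset (Fin n))
      (Finset.range (n - 1)) := by
    intro j hj
    simp only [Finset.coe_range, Set.mem_Iio]
    have : R j ⊂ Finset.univ.erase i := Finset.ssubset_iff_subset_ne.2
      ⟨Finset.filter_subset _ _, fun he => by
        have : j ∈ R j := he ▸ hj
        exact lt_irrefl _ (Finset.mem_filter.1 this).2⟩
    have := Finset.card_lt_card this
    rwa [Finset.card_erase_of_mem (Finset.mem_univ i), Finset.card_univ, Fintype.card_fin] at this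
  have hsurj := Finset.surjOn_of_injOn_of_card_le _ hmaps hinj (by simp)
  obtain ⟨j, hj, hjk⟩ := hsurj (show k - 1 ∈ ((Finset.range (n - 1) : Finset ℕ) : Set ℕ) by
    simp; omega)
  have hji : j ≠ i := Finset.ne_of_mem_erase hj
  refine ⟨⟨j, R j⟩, mem_rankings.2 ⟨hji, by simp [R], by simp [R], hjk⟩, ⟨?_, ?_⟩, ?_⟩
  · intro l hl
    exact (Finset.mem_filter.1 hl).2
  · intro l hl hli hlj
    have : ¬ s j < s l := fun h => hl (Finset.mem_filter.2 ⟨by simp [hli], h⟩)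
    exact lt_of_le_of_ne (not_lt.1 this) (hs.ne hlj)
  · rintro ⟨j', A'⟩ hp ⟨h1, h2⟩
    obtain ⟨g1, g2, g3, g4⟩ := mem_rankings.1 hp
    simp only at g1 g2 g3 g4 h1 h2
    have hA : A' = R j' := by
      ext l
      simp only [R, Finset.mem_filter, Finset.mem_erase, Finset.mem_univ, and_true]
      constructor
      · intro hl
        exact ⟨fun h => g2 (h ▸ hl), h1 l hl⟩
      · rintro ⟨hli, hl⟩
        by_contra hlA
        by_cases hlj : l = j'
        · rw [hlj] at hl; exact lt_irrefl _ hl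
        · exact lt_asymm hl (h2 l hlA hli hlj)
    have : j' = j := hinj (by simpa using g1) hj (by
      simp only at hjk ⊢
      rw [hjk, ← hA, g4])
    subst this
    rw [hA]

/-- A bidder facing the opponents' bids wins iff the own bid exceeds the `k`-th highest of them,
which then is the `(k+1)`-th highest bid. -/
theorem payoff_of_rankEvent {n k : ℕ} (hk : 2 ≤ k) (c δ : ℝ) {β : ℝ → ℝ}
    {I : Set ℝ} (hβ : StrictMonoOn β I) {i : Fin n} {p : (_ : Fin n) × Finset (Fin n)}
    (hp : p ∈ rankings k i) {s : Fin n → ℝ} (hs : ∀ l, s l ∈ I) (hr : RankEvent i p.1 p.2 s)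
    (x a : ℝ) [Decidable (β (s p.1) < a)] :
    payoff k c δ (Function.update s i x) (Function.update (fun j => β (s j)) i a) i =
      if β (s p.1) < a then
        value c (Function.update s i x) i - δ * a - (1 - δ) * β (s p.1) else 0 := by
  classical
  obtain ⟨j, A⟩ := p
  obtain ⟨hji, hiA, hjA, hA⟩ := mem_rankings.1 hp
  obtain ⟨hr1, hr2⟩ := hr
  simp only at hji hiA hjA hA hr1 hr2 ⊢
  have hcard1 : (insert i A).card = k := by
    rw [Finset.card_insert_of_notMem hiA, hA]; omega
  have hcard2 : (insert j (insert i A)).card = k + 1 := by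
    rw [Finset.card_insert_of_notMem (by simp [hji, hjA]), hcard1]
  set b := Function.update (fun j => β (s j)) i a with hb
  have hbi : b i = a := by simp [hb]
  have hbl : ∀ l, l ≠ i → b l = β (s l) := fun l hl => by simp [hb, hl]
  have hbA : ∀ l ∈ A, β (s j) < b l := fun l hl => by
    rw [hbl l (fun h => hiA (h ▸ hl))]
    exact hβ (hs _) (hs _) (hr1 l hl)
  by_cases h : β (s j) < a
  · have hkth : kthHighest (k + 1) b = β (s j) := by
      refine kthHighest_eq ?_ ?_
      · rw [← hcard2]
        refine Finset.card_le_card fun l hl => ?_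
        simp only [Finset.mem_insert] at hl
        simp only [Finset.mem_filter, Finset.mem_univ, true_and]
        rcases hl with rfl | rfl | hl
        · rw [hbl _ hji]
        · rw [hbi]; exact h.le
        · exact (hbA l hl).le
      · refine Nat.lt_succ_of_le ?_
        rw [← hcard1]
        refine Finset.card_le_card fun l hl => ?_
        simp only [Finset.mem_filter, Finset.mem_univ, true_and] at hl
        by_contra hl'
        simp only [Finset.mem_insert, not_or] at hl'
        rw [hbl l hl'.1] at hl
        have hlj : l ≠ j := by rintro rfl; exact lt_irrefl _ hl
        exact lt_asymm hl (hβ (hs _) (hs _) (hr2 l hl'.2 hl'.1 hlj))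
    have hw : Wins k b i := by rw [Wins, hkth, hbi]; exact h
    rw [payoff, price, if_pos hw, if_pos hw, if_pos h, hkth, hbi]
    ring
  · have hw : ¬ Wins k b i := by
      rw [Wins, hbi, not_lt]
      refine le_kthHighest (m := k + 1) (Nat.succ_pos k) ?_
      rw [← hcard2]
      refine Finset.card_le_card fun l hl => ?_
      simp only [Finset.mem_insert] at hl
      simp only [Finset.mem_filter, Finset.mem_univ, true_and]
      rcases hl with rfl | rfl | hl
      · rw [hbl _ hji]; exact not_lt.1 h
      · rw [hbi]
      · exact (not_lt.1 h).trans (hbA l hl).le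
    rw [payoff, price, if_neg hw, if_neg hw, if_neg h, sub_zero]

theorem value_update {n : ℕ} (c : ℝ) (s : Fin n → ℝ) (i : Fin n) (x : ℝ) :
    value c (Function.update s i x) i =
      (1 - c + c / n) * x + c / n * ∑ l ∈ Finset.univ.erase i, s l := by
  rw [value, Function.update_self, ← Finset.add_sum_erase _ _ (Finset.mem_univ i),
    Function.update_self]
  rw [Finset.sum_congr rfl fun l hl => Function.update_of_ne (Finset.ne_of_mem_erase hl) x s]
  ring

end MixedAuction

/-! ### Integration over the ranking of the opponents -/

namespace MixedAuction

/-- Conditionally on the coordinate `j` of a product measure, the integral of a product of functions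
of the single coordinates factorizes. -/
theorem integral_prod_conditioned {n : ℕ} (μ : Measure ℝ) [IsProbabilityMeasure μ] (j : Fin n)
    (φ : Fin n → ℝ → ℝ → ℝ)
    (hi : Integrable (fun s : Fin n → ℝ => ∏ l, φ l (s j) (s l)) (Measure.pi fun _ => μ)) :
    Integrable (fun t => φ j t t * ∏ l ∈ Finset.univ.erase j, ∫ y, φ l t y ∂μ) μ ∧
    ∫ s : Fin n → ℝ, ∏ l, φ l (s j) (s l) ∂(Measure.pi fun _ => μ) =
      ∫ t, φ j t t * ∏ l ∈ Finset.univ.erase j, ∫ y, φ l t y ∂μ ∂μ := by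
  obtain ⟨m, rfl⟩ : ∃ m, n = m + 1 := ⟨n - 1, by have := j.pos; omega⟩
  have hmp := measurePreserving_piFinSuccAbove (fun _ : Fin (m + 1) => μ) j
  have hme := (MeasurableEquiv.piFinSuccAbove (fun _ : Fin (m + 1) => ℝ) j).measurableEmbedding
  set Φ : ℝ × (Fin m → ℝ) → ℝ := fun z =>
    φ j z.1 z.1 * ∏ l, φ (j.succAbove l) z.1 (z.2 l) with hΦ
  have hcomp : (fun s : Fin (m + 1) → ℝ => ∏ l, φ l (s j) (s l)) =
      Φ ∘ MeasurableEquiv.piFinSuccAbove (fun _ : Fin (m + 1) => ℝ) j := by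
    funext s
    rw [Fin.prod_univ_succAbove _ j]
    rfl
  have hiΦ : Integrable Φ (μ.prod (Measure.pi fun _ : Fin m => μ)) := by
    rw [hcomp] at hi
    exact (hmp.integrable_comp_emb hme).1 hi
  have hinner : ∀ t, ∫ y : Fin m → ℝ, Φ (t, y) ∂(Measure.pi fun _ => μ) =
      φ j t t * ∏ l ∈ Finset.univ.erase j, ∫ y, φ l t y ∂μ := by
    intro t
    simp only [hΦ]
    rw [integral_const_mul, integral_fintype_prod_eq_prod (fun l y => φ (j.succAbove l) t y)]
    congr 1
    have e : (Finset.univ.erase j : Finset (Fin (m + 1))) =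
        Finset.univ.image j.succAbove := by
      ext l
      simp
    rw [e, Finset.prod_image fun a _ b _ h => Fin.succAbove_right_injective h]
  constructor
  · have := hiΦ.integral_prod_left
    simpa only [hinner] using this
  · rw [hcomp]
    have := hmp.integral_comp hme Φ
    simp only [Function.comp_def] at this ⊢
    rw [this, integral_prod _ hiΦ]
    simp only [hinner]

end MixedAuction

namespace MixedAuction

/-- Up to a combinatorial factor, the density with respect to the signal law of the `k`-th highest
of `n - 1` independent signals. -/
noncomputable def winWeight (n k : ℕ) (μ : Measure ℝ) (t : ℝ) : ℝ :=
  μ.real (Set.Iio t) ^ (n - 1 - k) * μ.real (Set.Ioi t) ^ (k - 1)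

open Classical in
/-- The mean of `e` at the signal of bidder `l`, conditional on the ranking `p` and on the signal of
the bidder `p.1` being `t`. -/
noncomputable def rankMean {n : ℕ} (μ : Measure ℝ) (e : ℝ → ℝ) (p : (_ : Fin n) × Finset (Fin n))
    (l : Fin n) (t : ℝ) : ℝ :=
  if l = p.1 then e t else if l ∈ p.2 then (∫ y in Set.Ioi t, e y ∂μ) / μ.real (Set.Ioi t)
  else (∫ y in Set.Iio t, e y ∂μ) / μ.real (Set.Iio t)

theorem measurableSet_rankEvent {n : ℕ} (i j : Fin n) (A : Finset (Fin n)) :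
    MeasurableSet {s : Fin n → ℝ | RankEvent i j A s} := by
  have : {s : Fin n → ℝ | RankEvent i j A s} =
      (⋂ l ∈ A, {s | s j < s l}) ∩ ⋂ l ∈ Finset.univ.filter (fun l => l ∉ A ∧ l ≠ i ∧ l ≠ j),
        {s | s l < s j} := by
    ext s
    simp only [RankEvent, Set.mem_ofPred_eq, Set.mem_inter_iff, Set.mem_iInter, Finset.mem_filter,
      Finset.mem_univ, true_and, and_imp]
  rw [this]
  refine (Finset.measurableSet_biInter _ fun l _ => ?_).inter
    (Finset.measurableSet_biInter _ fun l _ => ?_)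
  · exact measurableSet_lt (measurable_pi_apply _) (measurable_pi_apply _)
  · exact measurableSet_lt (measurable_pi_apply _) (measurable_pi_apply _)

theorem prod_ite_eq_winWeight {n k : ℕ} (hk : 2 ≤ k) {i : Fin n}
    {p : (_ : Fin n) × Finset (Fin n)} (hp : p ∈ rankings k i) (a b : ℝ)
    [∀ l, Decidable (l ∈ p.2)] :
    ∏ l ∈ Finset.univ.erase p.1, (if l = i then 1 else if l ∈ p.2 then a else b) =
      b ^ (n - 1 - k) * a ^ (k - 1) := by
  obtain ⟨h1, h2, h3, h4⟩ := mem_rankings.1 hp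
  rw [← Finset.mul_prod_erase _ _ (show i ∈ Finset.univ.erase p.1 by simp [h1.symm]), if_pos rfl,
    one_mul, Finset.prod_congr rfl fun l hl => if_neg (Finset.ne_of_mem_erase hl),
    Finset.prod_ite, Finset.prod_const, Finset.prod_const, mul_comm]
  have e1 : ((Finset.univ.erase p.1).erase i).filter (fun l => l ∈ p.2) = p.2 := by
    ext l
    simp only [Finset.mem_filter, Finset.mem_erase, Finset.mem_univ, and_true]
    constructor
    · exact fun h => h.2
    · intro h
      refine ⟨⟨?_, ?_⟩, h⟩
      · rintro rfl; exact h2 h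
      · rintro rfl; exact h3 h
  have e2 := Finset.card_filter_add_card_filter_not (s := (Finset.univ.erase p.1).erase i)
    (fun l => l ∈ p.2)
  rw [e1, h4, Finset.card_erase_of_mem (by simp [h1.symm]), Finset.card_erase_of_mem (by simp),
    Finset.card_univ, Fintype.card_fin] at e2
  rw [e1, h4]
  congr 2
  omega

variable {n k : ℕ} {μ : Measure ℝ} [IsProbabilityMeasure μ]

open Classical in
/-- The contribution of one ranking to an expectation that depends on the signal of the bidder `p.1`
holding the `k`-th highest opposing signal, and linearly on `e` at one further signal. -/
theorem integral_rankEvent (hk : 2 ≤ k) {i : Fin n} {p : (_ : Fin n) × Finset (Fin n)}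
    (hp : p ∈ rankings k i) (hpos : ∀ᵐ t ∂μ, 0 < μ.real (Set.Iio t) ∧ 0 < μ.real (Set.Ioi t))
    {ψ e : ℝ → ℝ} {C : ℝ} (hψ : AEStronglyMeasurable ψ μ) (hC : ∀ᵐ t ∂μ, |ψ t| ≤ C)
    (he : Integrable e μ) {l₀ : Fin n} (hl₀ : l₀ ≠ i) :
    Integrable (fun s : Fin n → ℝ => if RankEvent i p.1 p.2 s then ψ (s p.1) * e (s l₀) else 0)
      (Measure.pi fun _ => μ) ∧
    Integrable (fun t => ψ t * (rankMean μ e p l₀ t * winWeight n k μ t)) μ ∧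
    ∫ s : Fin n → ℝ, (if RankEvent i p.1 p.2 s then ψ (s p.1) * e (s l₀) else 0)
      ∂(Measure.pi fun _ => μ) =
      ∫ t, ψ t * (rankMean μ e p l₀ t * winWeight n k μ t) ∂μ := by
  obtain ⟨hji, hiA, hjA, hA⟩ := mem_rankings.1 hp
  set j := p.1 with hj
  set A := p.2 with hAdef
  -- the integrand as a product over the bidders, given the signal `t` of bidder `j`
  set φ : Fin n → ℝ → ℝ → ℝ := fun l t y =>
    (if l = i then 1 else if l = j then ψ y else if l ∈ A then (Set.Ioi t).indicator 1 y
      else (Set.Iio t).indicator 1 y) * (if l = l₀ then e y else 1) with hφ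
  have hprod : ∀ s : Fin n → ℝ, ∏ l, φ l (s j) (s l) =
      if RankEvent i j A s then ψ (s j) * e (s l₀) else 0 := by
    intro s
    simp only [hφ]
    rw [Finset.prod_mul_distrib, Finset.prod_ite_eq' Finset.univ l₀, if_pos (Finset.mem_univ _)]
    by_cases hr : RankEvent i j A s
    · rw [if_pos hr]
      congr 1
      rw [Finset.prod_eq_single j]
      · rw [if_neg hji, if_pos rfl]
      · intro l _ hlj
        by_cases hli : l = i
        · rw [if_pos hli]
        · rw [if_neg hli, if_neg hlj]
          by_cases hlA : l ∈ A
          · rw [if_pos hlA, Set.indicator_of_mem (show s l ∈ Set.Ioi (s j) from hr.1 l hlA)]; rfl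
          · rw [if_neg hlA, Set.indicator_of_mem
              (show s l ∈ Set.Iio (s j) from hr.2 l hlA hli hlj)]; rfl
      · simp
    · rw [if_neg hr]
      have : ∃ l, (l ∈ A ∧ ¬ s j < s l) ∨ (l ∉ A ∧ l ≠ i ∧ l ≠ j ∧ ¬ s l < s j) := by
        by_contra! hcon
        exact hr ⟨fun l hl => (hcon l).1 hl, fun l h1 h2 h3 => (hcon l).2 h1 h2 h3⟩
      obtain ⟨l, ⟨hlA, hl⟩ | ⟨hlA, hli, hlj, hl⟩⟩ := this
      · rw [Finset.prod_eq_zero (Finset.mem_univ l), zero_mul]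
        rw [if_neg (fun h : l = i => hiA (h ▸ hlA)), if_neg (fun h : l = j => hjA (h ▸ hlA)),
          if_pos hlA,
          Set.indicator_of_notMem (by simpa using hl)]
      · rw [Finset.prod_eq_zero (Finset.mem_univ l), zero_mul]
        rw [if_neg hli, if_neg hlj, if_neg hlA, Set.indicator_of_notMem (by simpa using hl)]
  have hint : Integrable (fun s : Fin n → ℝ =>
      if RankEvent i j A s then ψ (s j) * e (s l₀) else 0) (Measure.pi fun _ => μ) := by
    have h1 : Integrable (fun s : Fin n → ℝ => e (s l₀)) (Measure.pi fun _ => μ) :=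
      (measurePreserving_eval (fun _ : Fin n => μ) l₀).integrable_comp_of_integrable he
    have hq := Measure.quasiMeasurePreserving_eval (fun _ : Fin n => μ) j
    have h2 : AEStronglyMeasurable (fun s : Fin n → ℝ => ψ (s j)) (Measure.pi fun _ => μ) :=
      hψ.comp_quasiMeasurePreserving hq
    have h3 : ∀ᵐ s ∂(Measure.pi fun _ : Fin n => μ), ‖ψ (s j)‖ ≤ C := hq.ae hC
    have h4 := (Integrable.bdd_mul h1 h2 h3).indicator (measurableSet_rankEvent i j A)
    refine h4.congr (Filter.Eventually.of_forall fun s => ?_)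
    simp only [Set.indicator_apply, Set.mem_ofPred_eq]
  have hinner : ∀ᵐ t ∂μ, φ j t t * ∏ l ∈ Finset.univ.erase j, ∫ y, φ l t y ∂μ =
      ψ t * (rankMean μ e p l₀ t * winWeight n k μ t) := by
    filter_upwards [hpos] with t ht
    obtain ⟨hF, hS⟩ := ht
    have e1 : ∀ l ∈ Finset.univ.erase j, ∫ y, φ l t y ∂μ =
        (if l = i then 1 else if l ∈ A then μ.real (Set.Ioi t) else μ.real (Set.Iio t)) *
          (if l = l₀ then rankMean μ e p l₀ t else 1) := by
      intro l hl
      have hlj := Finset.ne_of_mem_erase hl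
      simp only [hφ, if_neg hlj]
      by_cases hli : l = i
      · have hne : ¬ l = l₀ := fun h => hl₀ (h ▸ hli)
        simp [hli, hl₀.symm]
      simp only [if_neg hli]
      have i1 : ∀ (B : Set ℝ), MeasurableSet B → ∀ v : ℝ → ℝ,
          ∫ y, B.indicator 1 y * v y ∂μ = ∫ y in B, v y ∂μ := by
        intro B hB v
        rw [← integral_indicator hB]
        congr 1
        ext y
        by_cases hy : y ∈ B <;> simp [hy]
      by_cases hlA : l ∈ A
      · simp only [if_pos hlA]
        rw [i1 _ measurableSet_Ioi]
        by_cases hll : l = l₀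
        · subst hll
          simp only [if_pos]
          rw [rankMean, if_neg hlj, if_pos hlA]
          field_simp
        · simp [if_neg hll]
      · simp only [if_neg hlA]
        rw [i1 _ measurableSet_Iio]
        by_cases hll : l = l₀
        · subst hll
          simp only [if_pos]
          rw [rankMean, if_neg hlj, if_neg hlA]
          field_simp
        · simp [if_neg hll]
    rw [Finset.prod_congr rfl e1, Finset.prod_mul_distrib, prod_ite_eq_winWeight hk hp]
    have e2 : φ j t t * ∏ l ∈ Finset.univ.erase j, (if l = l₀ then rankMean μ e p l₀ t else 1) =
        ψ t * rankMean μ e p l₀ t := by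
      rw [Finset.prod_ite_eq']
      simp only [hφ, if_neg hji, if_pos]
      by_cases hjl : j = l₀
      · rw [if_pos hjl, if_neg (by simp [hjl]), rankMean, if_pos hjl.symm, mul_one]
      · rw [if_neg hjl, if_pos (by simp [Ne.symm hjl]), mul_one]
    rw [winWeight, mul_left_comm, e2]
    ring
  have hi : Integrable (fun s : Fin n → ℝ => ∏ l, φ l (s j) (s l)) (Measure.pi fun _ => μ) := by
    rw [funext hprod]
    exact hint
  obtain ⟨h1, h2⟩ := integral_prod_conditioned μ j φ hi
  refine ⟨hint, h1.congr hinner, ?_⟩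
  rw [funext hprod] at h2
  rw [h2]
  exact integral_congr_ae hinner

theorem ae_injective [NullSingletonClass μ] :
    ∀ᵐ s ∂(Measure.pi fun _ : Fin n => μ), Function.Injective s := by
  have : ∀ i j : Fin n, i ≠ j → ∀ᵐ s ∂(Measure.pi fun _ : Fin n => μ), s i ≠ s j := by
    intro i j hij
    obtain ⟨m, rfl⟩ : ∃ m, n = m + 1 := ⟨n - 1, by have := j.pos; omega⟩
    obtain ⟨l, rfl⟩ := Fin.exists_succAbove_eq hij
    have hmp := measurePreserving_piFinSuccAbove (fun _ : Fin (m + 1) => μ) j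
    have h : ∀ᵐ z ∂(μ.prod (Measure.pi fun _ : Fin m => μ)), z.2 l ≠ z.1 := by
      have hm : MeasurableSet {z : ℝ × (Fin m → ℝ) | z.2 l ≠ z.1} := by
        have h0 : MeasurableSet {z : ℝ × (Fin m → ℝ) | z.2 l = z.1} :=
          measurableSet_eq_fun ((measurable_pi_apply l).comp measurable_snd) measurable_fst
        have e : {z : ℝ × (Fin m → ℝ) | z.2 l ≠ z.1} = {z | z.2 l = z.1}ᶜ := by
          ext z
          simp
        exact e ▸ h0.compl
      rw [Measure.ae_prod_iff_ae_ae hm]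
      refine Filter.Eventually.of_forall fun t => ?_
      exact Measure.ae_eval_ne (fun _ : Fin m => μ) l t
    exact hmp.quasiMeasurePreserving.ae h
  have h2 : ∀ᵐ s ∂(Measure.pi fun _ : Fin n => μ), ∀ i j : Fin n, i ≠ j → s i ≠ s j := by
    simp only [ae_all_iff]
    exact this
  filter_upwards [h2] with s hs i j hij
  by_contra hne
  exact hs i j hne hij

end MixedAuction

/-! ### The interim utility -/

namespace MixedAuction

/-- The expected sum of the opponents' signals when the `k`-th highest of them equals `t`. -/
noncomputable def opponentsMean (n k : ℕ) (μ : Measure ℝ) (t : ℝ) : ℝ :=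
  t + (k - 1) * aboveMean μ t + (n - 1 - k) * belowMean μ t

theorem sum_rankMean {n k : ℕ} (hk : 2 ≤ k) (hkn : k < n) (μ : Measure ℝ) {i : Fin n}
    {p : (_ : Fin n) × Finset (Fin n)} (hp : p ∈ rankings k i) (t : ℝ) :
    ∑ l ∈ Finset.univ.erase i, rankMean μ (fun y => y) p l t = opponentsMean n k μ t := by
  classical
  obtain ⟨h1, h2, h3, h4⟩ := mem_rankings.1 hp
  rw [← Finset.add_sum_erase _ _ (show p.1 ∈ Finset.univ.erase i by simp [h1])]
  have e0 : ∀ l ∈ (Finset.univ.erase i).erase p.1, rankMean μ (fun y => y) p l t =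
      if l ∈ p.2 then aboveMean μ t else belowMean μ t := by
    intro l hl
    rw [rankMean, if_neg (Finset.ne_of_mem_erase hl)]
    by_cases hlA : l ∈ p.2
    · rw [if_pos hlA, if_pos hlA, aboveMean]
    · rw [if_neg hlA, if_neg hlA, belowMean]
  have e1 : ((Finset.univ.erase i).erase p.1).filter (fun l => l ∈ p.2) = p.2 := by
    ext l
    simp only [Finset.mem_filter, Finset.mem_erase, Finset.mem_univ, and_true]
    constructor
    · exact fun h => h.2
    · intro h
      refine ⟨⟨?_, ?_⟩, h⟩
      · rintro rfl; exact h3 h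
      · rintro rfl; exact h2 h
  have e2 := Finset.card_filter_add_card_filter_not (s := (Finset.univ.erase i).erase p.1)
    (fun l => l ∈ p.2)
  rw [e1, h4, Finset.card_erase_of_mem (by simp [h1]), Finset.card_erase_of_mem (by simp),
    Finset.card_univ, Fintype.card_fin] at e2
  rw [Finset.sum_congr rfl e0, Finset.sum_ite, Finset.sum_const, Finset.sum_const, e1, h4,
    show (((Finset.univ.erase i).erase p.1).filter (fun l => l ∉ p.2)).card = n - 1 - k by omega,
    rankMean, if_pos rfl, opponentsMean, nsmul_eq_mul, nsmul_eq_mul,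
    Nat.cast_sub (by omega), Nat.cast_sub (by omega), Nat.cast_sub (by omega)]
  push_cast
  ring

variable {n k : ℕ} {μ : Measure ℝ} [IsProbabilityMeasure μ]

open Classical in
/-- The interim utility as an integral over the `k`-th highest opposing signal. Summing
`integral_rankEvent` over the rankings produces the combinatorial factor `(rankings k i).card`. -/
theorem interimUtility_eq [NullSingletonClass μ] (hk : 2 ≤ k) (hkn : k < n) {I : Set ℝ}
    (hI : MeasurableSet I) (hμI : μ Iᶜ = 0)
    (hpos : ∀ t ∈ I, 0 < μ.real (Set.Iio t) ∧ 0 < μ.real (Set.Ioi t))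
    (hint : Integrable (fun x : ℝ => x) μ) {β : ℝ → ℝ} (hβ : StrictMonoOn β I)
    (h0 : ∀ x ∈ I, 0 ≤ β x) (c δ : ℝ) (i : Fin n) (x a : ℝ) :
    Integrable (fun t => (if β t < a then (1 - c + c / n) * x + c / n * opponentsMean n k μ t -
        δ * a - (1 - δ) * β t else 0) * winWeight n k μ t) μ ∧
    interimUtility μ k c δ β i x a = (rankings k i).card *
      ∫ t, (if β t < a then (1 - c + c / n) * x + c / n * opponentsMean n k μ t -
        δ * a - (1 - δ) * β t else 0) * winWeight n k μ t ∂μ := by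
  have haeI : ∀ᵐ t ∂μ, t ∈ I := by
    rw [ae_iff]
    exact hμI
  have hβm : AEMeasurable β μ := by
    have := aemeasurable_restrict_of_monotoneOn (μ := μ) hI hβ.monotoneOn
    rwa [Measure.restrict_eq_self_of_ae_mem haeI] at this
  have hposae : ∀ᵐ t ∂μ, 0 < μ.real (Set.Iio t) ∧ 0 < μ.real (Set.Ioi t) :=
    haeI.mono fun t ht => hpos t ht
  set ψ₁ : ℝ → ℝ := fun t => if β t < a then (1 - c + c / n) * x - δ * a - (1 - δ) * β t else 0
    with hψ₁
  set ψ₂ : ℝ → ℝ := fun t => if β t < a then c / n else 0 with hψ₂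
  have m1 : AEStronglyMeasurable ψ₁ μ := by
    have : Measurable fun b : ℝ => if b < a then (1 - c + c / n) * x - δ * a - (1 - δ) * b
        else 0 := Measurable.ite measurableSet_Iio (by fun_prop) measurable_const
    exact (this.comp_aemeasurable hβm).aestronglyMeasurable
  have m2 : AEStronglyMeasurable ψ₂ μ := by
    have : Measurable fun b : ℝ => if b < a then c / (n : ℝ) else 0 :=
      Measurable.ite measurableSet_Iio measurable_const measurable_const
    exact (this.comp_aemeasurable hβm).aestronglyMeasurable
  have b1 : ∀ᵐ t ∂μ, |ψ₁ t| ≤ |(1 - c + c / n) * x| + |δ * a| + |1 - δ| * |a| := by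
    filter_upwards [haeI] with t ht
    simp only [hψ₁]
    split_ifs with h
    · refine (abs_sub _ _).trans (add_le_add (abs_sub _ _) ?_)
      rw [abs_mul]
      refine mul_le_mul_of_nonneg_left ?_ (abs_nonneg _)
      rw [abs_of_nonneg (h0 t ht)]
      exact h.le.trans (le_abs_self a)
    · rw [abs_zero]; positivity
  have b2 : ∀ᵐ t ∂μ, |ψ₂ t| ≤ |c / n| := Filter.Eventually.of_forall fun t => by
    simp only [hψ₂]
    split_ifs
    · exact le_rfl
    · rw [abs_zero]; positivity
  -- constants are covered by the test function `1` at the bidder `p.1`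
  have T1 := fun p (hp : p ∈ rankings k i) =>
    integral_rankEvent hk hp hposae m1 b1 (integrable_const (1 : ℝ)) (mem_rankings.1 hp).1
  have T2 := fun p (hp : p ∈ rankings k i) l (hl : l ∈ Finset.univ.erase i) =>
    integral_rankEvent hk hp hposae m2 b2 hint (Finset.ne_of_mem_erase hl)
  have hpay : (fun s : Fin n → ℝ => payoff k c δ (Function.update s i x)
        (Function.update (fun j => β (s j)) i a) i) =ᵐ[Measure.pi fun _ : Fin n => μ]
      fun s => ∑ p ∈ rankings k i, ((if RankEvent i p.1 p.2 s then ψ₁ (s p.1) * 1 else 0) +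
        ∑ l ∈ Finset.univ.erase i, if RankEvent i p.1 p.2 s then ψ₂ (s p.1) * s l else 0) := by
    have hsI : ∀ᵐ s ∂(Measure.pi fun _ : Fin n => μ), ∀ l, s l ∈ I :=
      ae_all_iff.2 fun l => (Measure.quasiMeasurePreserving_eval (fun _ : Fin n => μ) l).ae haeI
    filter_upwards [hsI, ae_injective] with s hs hinj
    obtain ⟨p, hp, hr, huniq⟩ := exists_unique_ranking hk hkn i hinj
    rw [Finset.sum_eq_single_of_mem p hp]
    · rw [payoff_of_rankEvent hk c δ hβ hp hs hr, value_update]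
      simp only [if_pos hr, hψ₁, hψ₂]
      by_cases h : β (s p.1) < a
      · simp only [if_pos h, ← Finset.mul_sum]
        ring
      · simp [if_neg h]
    · intro p' hp' hne
      have : ¬ RankEvent i p'.1 p'.2 s := fun h => hne (huniq p' hp' h)
      simp only [if_neg this, Finset.sum_const_zero, add_zero]
  have hsplit : ∀ p ∈ rankings k i, ∀ t,
      ψ₁ t * (rankMean μ (fun _ => 1) p p.1 t * winWeight n k μ t) +
        ∑ l ∈ Finset.univ.erase i, ψ₂ t * (rankMean μ (fun y => y) p l t * winWeight n k μ t) =
      (if β t < a then (1 - c + c / n) * x + c / n * opponentsMean n k μ t -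
        δ * a - (1 - δ) * β t else 0) * winWeight n k μ t := by
    intro p hp t
    rw [← Finset.mul_sum, ← Finset.sum_mul, sum_rankMean hk hkn μ hp, rankMean, if_pos rfl]
    simp only [hψ₁, hψ₂]
    split_ifs <;> ring
  have hterm : ∀ p ∈ rankings k i, Integrable (fun t =>
      (if β t < a then (1 - c + c / n) * x + c / n * opponentsMean n k μ t -
        δ * a - (1 - δ) * β t else 0) * winWeight n k μ t) μ := by
    intro p hp
    simp only [← hsplit p hp]
    exact (T1 p hp).2.1.add (integrable_finsetSum _ fun l hl => (T2 p hp l hl).2.1)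
  obtain ⟨p₀, hp₀⟩ := rankings_nonempty hk hkn i
  refine ⟨hterm p₀ hp₀, ?_⟩
  rw [interimUtility, integral_congr_ae hpay, integral_finsetSum]
  · rw [← nsmul_eq_mul, ← Finset.sum_const]
    refine Finset.sum_congr rfl fun p hp => ?_
    rw [integral_add (T1 p hp).1 (integrable_finsetSum _ fun l hl => (T2 p hp l hl).1),
      integral_finsetSum _ fun l hl => (T2 p hp l hl).1, (T1 p hp).2.2,
      Finset.sum_congr rfl fun l hl => (T2 p hp l hl).2.2,
      ← integral_finsetSum _ fun l hl => (T2 p hp l hl).2.1,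
      ← integral_add (T1 p hp).2.1 (integrable_finsetSum _ fun l hl => (T2 p hp l hl).2.1)]
    simp only [hsplit p hp]
  · intro p hp
    exact (T1 p hp).1.add (integrable_finsetSum _ fun l hl => (T2 p hp l hl).1)

end MixedAuction

/-! ### Incentive compatibility -/

namespace MixedAuction
open Filter Topology
namespace IsBidProblem

variable {I : Set ℝ} {g V : ℝ → ℝ}

open Classical in
/-- The interim utility, up to the combinatorial factor, as an integral over the `k`-th highest
opposing signal `t`; the expected value of an item to a bidder with signal `x` is
`V t + α * (x - t)`, where `α` is the weight of the own signal. -/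
noncomputable def reducedUtility (g V : ℝ → ℝ) (α δ : ℝ) (β : ℝ → ℝ) (x a : ℝ) : ℝ :=
  ∫ t, (if β t < a then V t + α * (x - t) - δ * a - (1 - δ) * β t else 0) * g t

theorem integrable_value (H : IsBidProblem I g V) {x : ℝ} (hx : x ∈ I) :
    IntervalIntegrable (fun t => V t * g t) volume 0 x :=
  H.integrable_monotone_mul H.value_strictMono.monotoneOn H.value_nonneg hx

theorem integrable_id (H : IsBidProblem I g V) {x : ℝ} (hx : x ∈ I) :
    IntervalIntegrable (fun t => t * g t) volume 0 x :=
  H.integrable_monotone_mul (ψ := fun t => t) (fun _ _ _ _ h => h) (fun x hx => (H.pos x hx).le) hx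

theorem integrable_gap (H : IsBidProblem I g V) (α y : ℝ) {x : ℝ} (hx : x ∈ I) :
    IntervalIntegrable (fun t => α * (y - t) * g t) volume 0 x := by
  have := ((H.integrable x hx).const_mul (α * y)).sub ((H.integrable_id hx).const_mul α)
  refine this.congr ?_
  intro t _
  simp only
  ring

theorem cumul_gap (H : IsBidProblem I g V) (α y : ℝ) {x : ℝ} (hx : x ∈ I) :
    cumul (fun t => α * (y - t) * g t) x =
      α * y * cumul g x - α * cumul (fun t => t * g t) x := by
  simp only [cumul]
  rw [← intervalIntegral.integral_const_mul, ← intervalIntegral.integral_const_mul,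
    ← intervalIntegral.integral_sub ((H.integrable x hx).const_mul _)
      ((H.integrable_id hx).const_mul _)]
  congr 1
  ext t
  ring

theorem reducedUtility_bid (H : IsBidProblem I g V) (hg : ∀ t, t ∉ I → g t = 0) (α δ : ℝ)
    {β : ℝ → ℝ} (hβ : StrictMonoOn β I) (h0 : ∀ x ∈ I, 0 ≤ β x) (x : ℝ) {z : ℝ} (hz : z ∈ I) :
    reducedUtility g V α δ β x (β z) =
      cumul (fun t => V t * g t) z + cumul (fun t => α * (x - t) * g t) z -
        (δ * β z * cumul g z + (1 - δ) * cumul (fun t => β t * g t) z) := by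
  have hβi := H.integrable_monotone_mul hβ.monotoneOn h0 hz
  have e : reducedUtility g V α δ β x (β z) =
      ∫ t, (Set.Ioc 0 z).indicator (fun t => V t * g t + α * (x - t) * g t -
        (δ * β z * g t + (1 - δ) * (β t * g t))) t := by
    refine integral_congr_ae ?_
    have hne : ∀ᵐ t : ℝ, t ≠ z := by simp [ae_iff]
    filter_upwards [hne] with t ht
    by_cases htI : t ∈ I
    · by_cases htz : t < z
      · rw [if_pos (hβ htI hz htz), Set.indicator_of_mem (show t ∈ Set.Ioc 0 z from
          ⟨H.pos t htI, htz.le⟩)]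
        ring
      · have : z < t := lt_of_le_of_ne (not_lt.1 htz) ht.symm
        rw [if_neg (not_lt.2 (hβ hz htI this).le), Set.indicator_of_notMem
          (fun h => not_le.2 this h.2), zero_mul]
    · rw [hg t htI, mul_zero, Set.indicator_of_notMem fun h => htI (H.Ioc_subset z hz h)]
  rw [e, integral_indicator measurableSet_Ioc,
    ← intervalIntegral.integral_of_le (H.pos z hz).le,
    intervalIntegral.integral_sub ((H.integrable_value hz).add (H.integrable_gap α x hz))
      (((H.integrable z hz).const_mul _).add (hβi.const_mul _)),
    intervalIntegral.integral_add (H.integrable_value hz) (H.integrable_gap α x hz),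
    intervalIntegral.integral_add ((H.integrable z hz).const_mul _) (hβi.const_mul _),
    intervalIntegral.integral_const_mul, intervalIntegral.integral_const_mul]
  rfl

theorem cumul_gap_le (H : IsBidProblem I g V) {α : ℝ} (hα : 0 ≤ α) {x z : ℝ} (hx : x ∈ I)
    (hz : z ∈ I) :
    cumul (fun t => α * (x - t) * g t) z ≤ cumul (fun t => α * (x - t) * g t) x := by
  rcases le_total z x with h | h
  · refine cumul_mono (H.pos z hz).le h (H.integrable_gap α x hx) fun t ht => ?_
    exact mul_nonneg (mul_nonneg hα (sub_nonneg.2 ht.2))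
      (H.weight_pos t (H.Ioc_subset x hx ht)).le
  · rw [← sub_nonneg]
    have := intervalIntegral.integral_interval_sub_left (H.integrable_gap α x hx)
      (H.integrable_gap α x hz)
    simp only [cumul]
    rw [this, intervalIntegral.integral_symm, ← intervalIntegral.integral_neg]
    refine intervalIntegral.integral_nonneg h fun t ht => ?_
    have := H.weight_pos t (H.Icc_subset hx hz ht)
    rw [← neg_mul, ← mul_neg, neg_sub]
    exact mul_nonneg (mul_nonneg hα (sub_nonneg.2 ht.1)) this.le

/-- Sufficiency of the integrated first-order condition: it reduces the utility from the bid `β z`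
to `∫₀ᶻ α (x - t) g`, which is largest at `z = x`. Any other bid `a` is dominated by the bids `β z < a`
in the limit of large `z`, which also covers bids in gaps and above the range of `β`. -/
theorem optimal_of_solves (H : IsBidProblem I g V) (hg : ∀ t, t ∉ I → g t = 0) {α δ : ℝ}
    (hα : 0 ≤ α) (hδ : 0 ≤ δ) {β : ℝ → ℝ} (hβ : StrictMonoOn β I) (h0 : ∀ x ∈ I, 0 ≤ β x)
    (hs : SolvesBidEquation I g V δ β) {x a : ℝ} (hx : x ∈ I)
    (hi : Integrable fun t =>
      open Classical in
      (if β t < a then V t + α * (x - t) - δ * a - (1 - δ) * β t else 0) * g t) :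
    reducedUtility g V α δ β x a ≤ reducedUtility g V α δ β x (β x) := by
  have hU : ∀ z ∈ I, reducedUtility g V α δ β x (β z) =
      cumul (fun t => α * (x - t) * g t) z := fun z hz => by
    rw [H.reducedUtility_bid hg α δ hβ h0 x hz, hs z hz]
    ring
  set A : Set ℝ := {t | t ∈ I ∧ β t < a} with hA
  rcases A.eq_empty_or_nonempty with hemp | hne
  · have e : reducedUtility g V α δ β x a = 0 := by
      rw [reducedUtility]
      refine integral_eq_zero_of_ae (Eventually.of_forall fun t => ?_)
      by_cases htI : t ∈ I
      · have : ¬ β t < a := fun h => by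
          have : t ∈ A := ⟨htI, h⟩
          rw [hemp] at this
          exact this
        simp [if_neg this]
      · simp [hg t htI]
    rw [e, hU x hx, cumul, intervalIntegral.integral_of_le (H.pos x hx).le]
    refine setIntegral_nonneg measurableSet_Ioc fun t ht => ?_
    exact mul_nonneg (mul_nonneg hα (sub_nonneg.2 ht.2))
      (H.weight_pos t (H.Ioc_subset x hx ht)).le
  · have hord : A.OrdConnected := ⟨fun s hs t ht r hr => by
      have hrI : r ∈ I := H.Icc_subset hs.1 ht.1 hr
      exact ⟨hrI, (hβ.monotoneOn hrI ht.1 hr.2).trans_lt ht.2⟩⟩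
    have : Nonempty A := hne.to_subtype
    have hlim := tendsto_setIntegral_of_monotone (ι := A) (s := fun z : A => Set.Iic (z : ℝ))
      (fun _ => measurableSet_Iic) (fun y z hyz => Set.Iic_subset_Iic.2 hyz) (hi.integrableOn)
    have hfull : ∫ t in ⋃ z : A, Set.Iic (z : ℝ),
        (open Classical in
        (if β t < a then V t + α * (x - t) - δ * a - (1 - δ) * β t else 0) * g t) =
        reducedUtility g V α δ β x a := by
      refine setIntegral_eq_integral_of_forall_compl_eq_zero fun t ht => ?_
      by_cases htI : t ∈ I
      · have : ¬ β t < a := fun h => ht (Set.mem_iUnion.2 ⟨⟨t, htI, h⟩, Set.mem_Iic.2 le_rfl⟩)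
        rw [if_neg this, zero_mul]
      · rw [hg t htI, mul_zero]
    rw [hfull] at hlim
    refine le_of_tendsto hlim (Eventually.of_forall fun z => ?_)
    obtain ⟨z, hzI, hza⟩ := z
    have hβi := H.integrable_monotone_mul hβ.monotoneOn h0 hzI
    have hz0 := H.pos z hzI
    -- on `(0, z]` raising the bid from `β z` to `a` only raises the payment
    calc _ = ∫ t in (0 : ℝ)..z,
        (V t * g t + α * (x - t) * g t - (δ * a * g t + (1 - δ) * (β t * g t))) := by
          rw [intervalIntegral.integral_of_le hz0.le]
          have hsub : Set.Ioc 0 z ⊆ Set.Iic z := fun t ht => ht.2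
          rw [setIntegral_eq_of_subset_of_forall_sdiff_eq_zero measurableSet_Iic hsub]
          · refine setIntegral_congr_fun measurableSet_Ioc fun t ht => ?_
            have htI := H.Ioc_subset z hzI ht
            rw [if_pos ((hβ.monotoneOn htI hzI ht.2).trans_lt hza)]
            ring
          · intro t ht
            have : t ∉ I := fun h => ht.2 ⟨H.pos t h, ht.1⟩
            rw [hg t this, mul_zero]
      _ ≤ ∫ t in (0 : ℝ)..z,
        (V t * g t + α * (x - t) * g t - (δ * β z * g t + (1 - δ) * (β t * g t))) := by
          refine intervalIntegral.integral_mono_on_of_le_Ioo hz0.le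
            (((H.integrable_value hzI).add (H.integrable_gap α x hzI)).sub
              (((H.integrable z hzI).const_mul _).add (hβi.const_mul _)))
            (((H.integrable_value hzI).add (H.integrable_gap α x hzI)).sub
              (((H.integrable z hzI).const_mul _).add (hβi.const_mul _))) fun t ht => ?_
          have := H.weight_pos t (H.Ioc_subset z hzI ⟨ht.1, ht.2.le⟩)
          have h2 : δ * β z * g t ≤ δ * a * g t :=
            mul_le_mul_of_nonneg_right (mul_le_mul_of_nonneg_left hza.le hδ) this.le
          linarith
      _ = reducedUtility g V α δ β x (β z) := by
          rw [H.reducedUtility_bid hg α δ hβ h0 x hzI,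
            intervalIntegral.integral_sub ((H.integrable_value hzI).add (H.integrable_gap α x hzI))
              (((H.integrable z hzI).const_mul _).add (hβi.const_mul _)),
            intervalIntegral.integral_add (H.integrable_value hzI) (H.integrable_gap α x hzI),
            intervalIntegral.integral_add ((H.integrable z hzI).const_mul _) (hβi.const_mul _),
            intervalIntegral.integral_const_mul, intervalIntegral.integral_const_mul]
          rfl
      _ ≤ _ := by
          rw [hU z hzI, hU x hx]
          exact H.cumul_gap_le hα hx hzI

/-- Necessity of the integrated first-order condition. Mutual incentive compatibility of the signals
`x` and `z` bounds the increment of its defect `Q` by `α (x - z) (G x - G z)`, so that `Q` has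
derivative zero although `β` is not known to be continuous; and `Q` vanishes at `0`. -/
theorem solves_of_optimal (H : IsBidProblem I g V) (hg : ∀ t, t ∉ I → g t = 0) {α δ : ℝ}
    (hα : 0 ≤ α) {β : ℝ → ℝ} (hβ : StrictMonoOn β I) (h0 : ∀ x ∈ I, 0 ≤ β x)
    (hopt : ∀ x ∈ I, ∀ z ∈ I,
      reducedUtility g V α δ β x (β z) ≤ reducedUtility g V α δ β x (β x)) :
    SolvesBidEquation I g V δ β := by
  have hβi := fun x hx => H.integrable_monotone_mul hβ.monotoneOn h0 (x := x) hx
  have hVi := fun x hx => H.integrable_value (x := x) hx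
  set Q : ℝ → ℝ := fun z => δ * (β z * cumul g z ^ (1 : ℝ)) +
    (1 - δ) * cumul (fun t => β t * g t) z - cumul (fun t => V t * g t) z with hQ
  have hle : ∀ x ∈ I, ∀ z ∈ I, z ≤ x → |Q x - Q z| ≤ α * ((x - z) * (cumul g x - cumul g z)) := by
    intro x hx z hz hzx
    have o1 := hopt x hx z hz
    have o2 := hopt z hz x hx
    simp only [H.reducedUtility_bid hg α δ hβ h0 _ hx, H.reducedUtility_bid hg α δ hβ h0 _ hz,
      H.cumul_gap _ _ hx, H.cumul_gap _ _ hz] at o1 o2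
    have i1 : ∀ y, α * y * (cumul g x - cumul g z) -
        α * (cumul (fun t => t * g t) x - cumul (fun t => t * g t) z) =
        ∫ t in z..x, α * (y - t) * g t := by
      intro y
      rw [← intervalIntegral.integral_interval_sub_left (H.integrable_gap α y hx)
        (H.integrable_gap α y hz)]
      have := H.cumul_gap α y hx
      have := H.cumul_gap α y hz
      simp only [cumul] at *
      linarith
    have i2 : 0 ≤ ∫ t in z..x, α * (x - t) * g t :=
      intervalIntegral.integral_nonneg hzx fun t ht => mul_nonneg
        (mul_nonneg hα (sub_nonneg.2 ht.2)) (H.weight_pos t (H.Icc_subset hz hx ht)).le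
    have i3 : 0 ≤ -∫ t in z..x, α * (z - t) * g t := by
      rw [← intervalIntegral.integral_neg]
      refine intervalIntegral.integral_nonneg hzx fun t ht => ?_
      rw [← neg_mul, ← mul_neg, neg_sub]
      exact mul_nonneg (mul_nonneg hα (sub_nonneg.2 ht.1))
        (H.weight_pos t (H.Icc_subset hz hx ht)).le
    rw [← i1] at i2 i3
    simp only [hQ, Real.rpow_one]
    rw [abs_le]
    constructor <;> linarith
  have hle' : ∀ x ∈ I, ∀ z ∈ I, |Q z - Q x| ≤ α * |(z - x) * (cumul g z - cumul g x)| := by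
    intro x hx z hz
    rcases le_total z x with h | h
    · rw [abs_sub_comm]
      refine (hle x hx z hz h).trans (mul_le_mul_of_nonneg_left ?_ hα)
      rw [show (x - z) * (cumul g x - cumul g z) = (z - x) * (cumul g z - cumul g x) by ring]
      exact le_abs_self _
    · exact (hle z hz x hx h).trans (mul_le_mul_of_nonneg_left (le_abs_self _) hα)
  have hd : ∀ x ∈ I, HasDerivAt Q 0 x := by
    intro x hx
    rw [hasDerivAt_iff_isLittleO]
    have hG : Tendsto (fun z => cumul g z - cumul g x) (𝓝 x) (𝓝 0) := by
      have := (H.continuousAt_cumul H.integrable hx).tendsto.sub_const (cumul g x)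
      rwa [sub_self] at this
    have h1 : (fun z => (z - x) * (cumul g z - cumul g x)) =o[𝓝 x] fun z => z - x := by
      have := (Asymptotics.isBigO_refl (fun z => z - x) (𝓝 x)).mul_isLittleO
        ((Asymptotics.isLittleO_one_iff ℝ).2 hG)
      simpa using this
    refine Asymptotics.IsBigO.trans_isLittleO (Asymptotics.IsBigO.of_bound α ?_) h1
    filter_upwards [H.isOpen.mem_nhds hx] with z hz
    simpa using hle' x hx z hz
  intro x hx
  have hI := H.Ioc_subset x hx
  have key := eq_zero_of_deriv_eq_zero (H.pos x hx) (fun t ht => hd t (hI ht)) (by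
    have t1 := H.tendsto_bdd_mul_cumul_rpow one_pos hx
      (abs_le_of_monotone hβ.monotoneOn h0 hI hx)
    have t2 := H.tendsto_cumul_zero ⟨x, hx⟩ hβi
    have t3 := H.tendsto_cumul_zero ⟨x, hx⟩ hVi
    have t4 := ((t1.const_mul δ).add (t2.const_mul (1 - δ))).sub t3
    simp only [mul_zero, add_zero, sub_zero] at t4
    exact t4)
  simp only [hQ, Real.rpow_one] at key
  linarith

end IsBidProblem
end MixedAuction

/-! ### The bidding problem of a log-concave density -/

namespace MixedAuction
open Filter Topology

theorem isOpen_openSupport (sbar : EReal) : IsOpen (openSupport sbar) :=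
  isOpen_Ioi.inter (isOpen_Iio.preimage continuous_coe_real_ereal)

theorem Ioc_subset_openSupport {sbar : EReal} {x : ℝ} (hx : x ∈ openSupport sbar) :
    Set.Ioc 0 x ⊆ openSupport sbar := fun _ ht =>
  ⟨ht.1, (EReal.coe_le_coe_iff.2 ht.2).trans_lt hx.2⟩

section Density

variable {μ : Measure ℝ} {I : Set ℝ} {f : ℝ → ℝ}

/-- The density may be cut off outside the support, where it is only known to be nonpositive almost
everywhere. -/
theorem eq_withDensity_indicator (hf : Measurable f)
    (hμ : μ = volume.withDensity fun x => ENNReal.ofReal (f x))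
    (hsupp : μ Iᶜ = 0) :
    μ = volume.withDensity fun x => ENNReal.ofReal (I.indicator f x) := by
  have h0 : volume ({x | ENNReal.ofReal (f x) ≠ 0} ∩ Iᶜ) = 0 := by
    rw [hμ] at hsupp
    exact (withDensity_apply_eq_zero hf.ennreal_ofReal).1 hsupp
  have h1 : (fun x => ENNReal.ofReal (f x)) =ᵐ[volume]
      fun x => ENNReal.ofReal (I.indicator f x) := by
    have h2 : ∀ᵐ x, ¬ (ENNReal.ofReal (f x) ≠ 0 ∧ x ∉ I) := by
      rw [ae_iff]
      convert h0 using 2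
      ext x
      simp
    filter_upwards [h2] with x hx
    by_cases hxI : x ∈ I
    · rw [Set.indicator_of_mem hxI]
    · rw [Set.indicator_of_notMem hxI, ENNReal.ofReal_zero]
      by_contra hne
      exact hx ⟨hne, hxI⟩
  rw [← withDensity_congr_ae h1]
  exact hμ

variable {d : ℝ → ℝ}

theorem integral_eq_of_density (hd : Measurable d) (hd0 : ∀ x, 0 ≤ d x)
    (hμ : μ = volume.withDensity fun x => ENNReal.ofReal (d x)) (ψ : ℝ → ℝ) :
    ∫ t, ψ t ∂μ = ∫ t, ψ t * d t := by
  rw [hμ, integral_withDensity_eq_integral_toReal_smul hd.ennreal_ofReal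
    (Eventually.of_forall fun _ => ENNReal.ofReal_lt_top)]
  refine integral_congr_ae (Eventually.of_forall fun t => ?_)
  simp only [ENNReal.toReal_ofReal (hd0 t), smul_eq_mul, mul_comm]

theorem integrable_iff_of_density (hd : Measurable d) (hd0 : ∀ x, 0 ≤ d x)
    (hμ : μ = volume.withDensity fun x => ENNReal.ofReal (d x)) (ψ : ℝ → ℝ) :
    Integrable ψ μ ↔ Integrable fun t => ψ t * d t := by
  rw [hμ, integrable_withDensity_iff_integrable_smul' hd.ennreal_ofReal
    (Eventually.of_forall fun _ => ENNReal.ofReal_lt_top)]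
  simp only [ENNReal.toReal_ofReal (hd0 _), smul_eq_mul, mul_comm]

theorem integrable_density [IsProbabilityMeasure μ] (hd : Measurable d) (hd0 : ∀ x, 0 ≤ d x)
    (hμ : μ = volume.withDensity fun x => ENNReal.ofReal (d x)) : Integrable d := by
  have := (integrable_iff_of_density hd hd0 hμ fun _ => 1).1 (integrable_const 1)
  simpa using this

theorem measureReal_eq_of_density (hd : Measurable d) (hd0 : ∀ x, 0 ≤ d x)
    (hμ : μ = volume.withDensity fun x => ENNReal.ofReal (d x)) {B : Set ℝ}
    (hB : MeasurableSet B) : μ.real B = ∫ t in B, d t := by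
  have h1 : ∫ t, B.indicator 1 t ∂μ = μ.real B := integral_indicator_one hB
  rw [← h1, integral_eq_of_density hd hd0 hμ, ← integral_indicator hB]
  congr 1
  ext t
  by_cases h : t ∈ B <;> simp [h]

theorem measureReal_pos_of_density [IsProbabilityMeasure μ] (hd : Measurable d)
    (hd0 : ∀ x, 0 ≤ d x)
    (hμ : μ = volume.withDensity fun x => ENNReal.ofReal (d x)) {a b : ℝ} (hab : a < b)
    (hpos : ∀ t ∈ Set.Ioo a b, 0 < d t) {B : Set ℝ}
    (hsub : Set.Ioo a b ⊆ B) : 0 < μ.real B := by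
  have h1 : 0 < ∫ t in a..b, d t := intervalIntegral.intervalIntegral_pos_of_pos_on
    (integrable_density hd hd0 hμ).intervalIntegrable hpos hab
  rw [intervalIntegral.integral_of_le hab.le, integral_Ioc_eq_integral_Ioo,
    ← measureReal_eq_of_density hd hd0 hμ measurableSet_Ioo] at h1
  exact h1.trans_le (measureReal_mono hsub)

theorem continuous_measureReal_Iio [IsProbabilityMeasure μ] (hd : Measurable d)
    (hd0 : ∀ x, 0 ≤ d x)
    (hμ : μ = volume.withDensity fun x => ENNReal.ofReal (d x)) :
    Continuous fun t => μ.real (Set.Iio t) := by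
  have hi := integrable_density hd hd0 hμ
  have e : (fun t => μ.real (Set.Iio t)) =
      fun t => (∫ r in Set.Iic 0, d r) + ∫ r in (0 : ℝ)..t, d r := by
    funext t
    rw [measureReal_eq_of_density hd hd0 hμ measurableSet_Iio, ← integral_Iic_eq_integral_Iio,
      ← intervalIntegral.integral_Iic_sub_Iic hi.integrableOn hi.integrableOn]
    ring
  rw [e]
  exact continuous_const.add
    (intervalIntegral.continuous_primitive (fun a b => hi.intervalIntegrable) 0)

end Density

/-- The value of an item to a bidder with signal `x` who ties with the `k`-th highest opponent. -/
noncomputable def tieValue (n k : ℕ) (μ : Measure ℝ) (c x : ℝ) : ℝ :=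
  (1 - c + c / n) * x + c / n * opponentsMean n k μ x

theorem ownSignalWeight_pos {n : ℕ} (hn : 0 < n) {c : ℝ} (hc0 : 0 ≤ c) (hc1 : c ≤ 1) :
    0 < 1 - c + c / n := by
  have hn : (0 : ℝ) < n := by exact_mod_cast hn
  rcases hc1.eq_or_lt with rfl | h
  · simpa using hn
  · have := div_nonneg hc0 hn.le
    linarith

section Setup

variable {n k : ℕ} {μ : Measure ℝ} [IsProbabilityMeasure μ] {sbar : EReal} {f : ℝ → ℝ}

theorem indicator_nonneg_of_pos (hpos : ∀ x ∈ openSupport sbar, 0 < f x) (x : ℝ) :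
    0 ≤ (openSupport sbar).indicator f x :=
  Set.indicator_nonneg (fun x hx => (hpos x hx).le) x

theorem measureReal_Iio_Ioi_pos (hf : Measurable f)
    (hμ : μ = volume.withDensity fun x => ENNReal.ofReal ((openSupport sbar).indicator f x))
    (hpos : ∀ x ∈ openSupport sbar, 0 < f x) {t : ℝ} (ht : t ∈ openSupport sbar) :
    0 < μ.real (Set.Iio t) ∧ 0 < μ.real (Set.Ioi t) := by
  have hI := isOpen_openSupport sbar
  have hd := hf.indicator hI.measurableSet
  have hd0 := indicator_nonneg_of_pos hpos
  constructor
  · refine measureReal_pos_of_density hd hd0 hμ ht.1 (fun r hr => ?_)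
      fun r hr => hr.2
    have := Ioc_subset_openSupport ht ⟨hr.1, hr.2.le⟩
    rw [Set.indicator_of_mem this]
    exact hpos r this
  · obtain ⟨y, hty, hy⟩ : ∃ y, t < y ∧ y ∈ openSupport sbar := by
      obtain ⟨y, hy⟩ := Filter.nonempty_of_mem (inter_mem
        (self_mem_nhdsWithin (a := t) (s := Set.Ioi t))
        (mem_nhdsWithin_of_mem_nhds (hI.mem_nhds ht)))
      exact ⟨y, hy.1, hy.2⟩
    refine measureReal_pos_of_density hd hd0 hμ hty (fun r hr => ?_)
      fun r hr => hr.1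
    have := Ioc_subset_openSupport hy ⟨ht.1.trans hr.1, hr.2.le⟩
    rw [Set.indicator_of_mem this]
    exact hpos r this

/-- For a log-concave density the weight of the `k`-th highest opposing signal is log-concave, and
the conditional means entering the tie value grow at rates between zero and one. -/
theorem isBidProblem (hk : 2 ≤ k) (hkn : k < n) {c : ℝ} (hc0 : 0 ≤ c) (hc1 : c ≤ 1)
    (hf : Measurable f)
    (hμ : μ = volume.withDensity fun x => ENNReal.ofReal ((openSupport sbar).indicator f x))
    (hpos : ∀ x ∈ openSupport sbar, 0 < f x) (hint : Integrable (fun x : ℝ => x) μ)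
    (hlog : ConcaveOn ℝ (openSupport sbar) fun x => Real.log (f x)) :
    IsBidProblem (openSupport sbar)
      (fun t => winWeight n k μ t * (openSupport sbar).indicator f t) (tieValue n k μ c) := by
  have hI := isOpen_openSupport sbar
  have hd := hf.indicator hI.measurableSet
  have hd0 := indicator_nonneg_of_pos hpos
  have hdi := integrable_density hd hd0 hμ
  have hFS := fun t (ht : t ∈ openSupport sbar) => measureReal_Iio_Ioi_pos hf hμ hpos ht
  have hlcd := MulLogConcave.of_concaveOn_log hpos hlog
  have hlcF : MulLogConcave fun t => μ.real (Set.Iio t) := by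
    simp only [measureReal_eq_of_density hd hd0 hμ measurableSet_Iio,
      ← integral_Iic_eq_integral_Iio]
    exact hlcd.setIntegral_Iic fun _ => hdi.integrableOn
  have hlcS : MulLogConcave fun t => μ.real (Set.Ioi t) := by
    simp only [measureReal_eq_of_density hd hd0 hμ measurableSet_Ioi]
    exact hlcd.setIntegral_Ioi hdi
  have hlcg : MulLogConcave fun t => winWeight n k μ t * (openSupport sbar).indicator f t :=
    ((hlcF.pow _).mul (hlcS.pow _)).mul hlcd
  have hFc := continuous_measureReal_Iio hd hd0 hμ
  have hSc : Continuous fun t => μ.real (Set.Ioi t) := by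
    have : NullSingletonClass μ := by rw [hμ]; infer_instance
    have e : (fun t => μ.real (Set.Ioi t)) = fun t => 1 - μ.real (Set.Iio t) := by
      funext t
      rw [← Set.compl_Iic, probReal_compl_eq_one_sub measurableSet_Iic,
        measureReal_congr (Iio_ae_eq_Iic (μ := μ) (a := t))]
    rw [e]
    exact continuous_const.sub hFc
  have hwc : Continuous (winWeight n k μ) := (hFc.pow _).mul (hSc.pow _)
  have hgi : Integrable fun t => winWeight n k μ t * (openSupport sbar).indicator f t := by
    refine hdi.bdd_mul (c := 1) hwc.aestronglyMeasurable (Eventually.of_forall fun t => ?_)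
    rw [winWeight, norm_mul, norm_pow, norm_pow, Real.norm_of_nonneg measureReal_nonneg,
      Real.norm_of_nonneg measureReal_nonneg]
    exact mul_le_one₀ (pow_le_one₀ measureReal_nonneg measureReal_le_one)
      (pow_nonneg measureReal_nonneg _) (pow_le_one₀ measureReal_nonneg measureReal_le_one)
  have hG : ∀ x ∈ openSupport sbar,
      cumul (fun t => winWeight n k μ t * (openSupport sbar).indicator f t) x =
      ∫ t in Set.Iic x, winWeight n k μ t * (openSupport sbar).indicator f t := by
    intro x hx
    rw [cumul, ← intervalIntegral.integral_Iic_sub_Iic hgi.integrableOn hgi.integrableOn,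
      sub_eq_self]
    refine setIntegral_eq_zero_of_forall_eq_zero fun t ht => ?_
    rw [Set.indicator_of_notMem (fun h => not_lt.2 (Set.mem_Iic.1 ht) h.1), mul_zero]
  have hn : (0 : ℝ) < n := by exact_mod_cast (by omega : 0 < n)
  have hα := ownSignalWeight_pos (by omega : 0 < n) hc0 hc1
  have hcn : 0 ≤ c / n := div_nonneg hc0 hn.le
  have hk1 : (0 : ℝ) ≤ k - 1 := by
    rw [sub_nonneg]; exact_mod_cast (by omega : 1 ≤ k)
  have hp : (0 : ℝ) ≤ n - 1 - k := by
    have : (k : ℝ) + 1 ≤ n := by exact_mod_cast hkn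
    linarith
  -- both conditional means grow, at rate at most one
  have hmeans : ∀ x ∈ openSupport sbar, ∀ y ∈ openSupport sbar, x ≤ y →
      (aboveMean μ x ≤ aboveMean μ y ∧ aboveMean μ y - y ≤ aboveMean μ x - x) ∧
      (belowMean μ x ≤ belowMean μ y ∧ x - belowMean μ x ≤ y - belowMean μ y) :=
    fun x hx y hy hxy => ⟨⟨aboveMean_mono hint hxy (hFS y hy).2,
      aboveMean_sub_anti hint hlcS hxy (hFS y hy).2⟩,
      belowMean_mono hint hxy (hFS x hx).1, sub_belowMean_mono hint hlcF hxy (hFS x hx).1⟩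
  have hnonneg : ∀ᵐ t ∂μ, 0 ≤ t := by
    rw [ae_iff, hμ, withDensity_apply_eq_zero hd.ennreal_ofReal]
    convert measure_empty (μ := (volume : Measure ℝ)) using 2
    ext t
    simp only [Set.mem_inter_iff, Set.mem_ofPred_eq, not_le, Set.mem_empty_iff_false, iff_false,
      not_and, not_lt, ne_eq]
    intro h
    by_contra! hlt
    exact h (by rw [Set.indicator_of_notMem fun h => lt_asymm hlt h.1, ENNReal.ofReal_zero])
  constructor
  · exact hI
  · exact fun x hx => hx.1
  · exact fun x hx => Ioc_subset_openSupport hx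
  · refine hwc.continuousOn.mul (ContinuousOn.congr (f := fun x => Real.exp (Real.log (f x)))
      (hlog.continuousOn hI).rexp fun x hx => ?_)
    rw [Set.indicator_of_mem hx]
    exact (Real.exp_log (hpos x hx)).symm
  · intro x hx
    rw [Set.indicator_of_mem hx, winWeight]
    exact mul_pos (mul_pos (pow_pos (hFS x hx).1 _) (pow_pos (hFS x hx).2 _)) (hpos x hx)
  · exact fun x hx => hgi.intervalIntegrable
  · intro x hx y hy hxy
    rw [hG x hx, hG y hy]
    simpa using hlcg.setIntegral_Iic_mul_le (fun _ => hgi.integrableOn) hxy 0 le_rfl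
  · intro x hx
    have h1 : 0 ≤ aboveMean μ x := div_nonneg
      (setIntegral_nonneg_of_ae (hnonneg.mono fun t ht => ht)) measureReal_nonneg
    have h2 : 0 ≤ belowMean μ x := div_nonneg
      (setIntegral_nonneg_of_ae (hnonneg.mono fun t ht => ht)) measureReal_nonneg
    have h3 : 0 ≤ x := hx.1.le
    rw [tieValue, opponentsMean]
    positivity
  · intro x hx y hy hxy
    obtain ⟨⟨h1, -⟩, h2, -⟩ := hmeans x hx y hy hxy.le
    have h3 : opponentsMean n k μ x ≤ opponentsMean n k μ y := by
      rw [opponentsMean, opponentsMean]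
      gcongr
    rw [tieValue, tieValue]
    exact add_lt_add_of_lt_of_le (mul_lt_mul_of_pos_left hxy hα)
      (mul_le_mul_of_nonneg_left h3 hcn)
  · intro x hx y hy hxy
    obtain ⟨⟨-, h1⟩, -, h2⟩ := hmeans x hx y hy hxy
    have h3 : opponentsMean n k μ y - opponentsMean n k μ x ≤ (n - 1) * (y - x) := by
      rw [opponentsMean, opponentsMean]
      have e1 : (k - 1) * (aboveMean μ y - aboveMean μ x) ≤ (k - 1) * (y - x) :=
        mul_le_mul_of_nonneg_left (by linarith) hk1
      have e2 : (n - 1 - k) * (belowMean μ y - belowMean μ x) ≤ (n - 1 - k) * (y - x) :=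
        mul_le_mul_of_nonneg_left (by linarith) hp
      linarith
    have h4 := mul_le_mul_of_nonneg_left h3 hcn
    have h5 : (1 - c + c / n) * (y - x) + c / n * ((n - 1) * (y - x)) = y - x := by
      field_simp
      ring
    rw [tieValue, tieValue]
    linarith

/-- The interim utility is a positive multiple of the reduced utility for the density. -/
theorem interimUtility_eq_reducedUtility (hk : 2 ≤ k) (hkn : k < n)
    (hf : Measurable f)
    (hμ : μ = volume.withDensity fun x => ENNReal.ofReal ((openSupport sbar).indicator f x))
    (hsupp : μ (openSupport sbar)ᶜ = 0)
    (hpos : ∀ x ∈ openSupport sbar, 0 < f x) (hint : Integrable (fun x : ℝ => x) μ)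
    {β : ℝ → ℝ} (hβ : StrictMonoOn β (openSupport sbar))
    (h0 : ∀ x ∈ openSupport sbar, 0 ≤ β x) (c δ : ℝ) (i : Fin n) (x a : ℝ) :
    (Integrable fun t =>
      open Classical in
      (if β t < a then tieValue n k μ c t + (1 - c + c / n) * (x - t) - δ * a - (1 - δ) * β t
        else 0) * (winWeight n k μ t * (openSupport sbar).indicator f t)) ∧
    interimUtility μ k c δ β i x a = (rankings k i).card *
      IsBidProblem.reducedUtility (fun t => winWeight n k μ t * (openSupport sbar).indicator f t)
        (tieValue n k μ c) (1 - c + c / n) δ β x a := by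
  classical
  have hI := isOpen_openSupport sbar
  have hd := hf.indicator hI.measurableSet
  have hd0 := indicator_nonneg_of_pos hpos
  have : NullSingletonClass μ := by rw [hμ]; infer_instance
  obtain ⟨h1, h2⟩ := interimUtility_eq hk hkn hI.measurableSet hsupp
    (fun t ht => measureReal_Iio_Ioi_pos hf hμ hpos ht) hint hβ h0 c δ i x a
  have e : ∀ t, (if β t < a then (1 - c + c / n) * x + c / n * opponentsMean n k μ t -
        δ * a - (1 - δ) * β t else 0) * winWeight n k μ t * (openSupport sbar).indicator f t =
      (if β t < a then tieValue n k μ c t + (1 - c + c / n) * (x - t) - δ * a - (1 - δ) * β t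
        else 0) * (winWeight n k μ t * (openSupport sbar).indicator f t) := by
    intro t
    rw [tieValue]
    split_ifs <;> ring
  constructor
  · have := (integrable_iff_of_density hd hd0 hμ _).1 h1
    refine this.congr (Eventually.of_forall fun t => ?_)
    convert e t
  · rw [h2, integral_eq_of_density hd hd0 hμ, IsBidProblem.reducedUtility]
    congr 2
    funext t
    convert e t

end Setup
end MixedAuction

/-! ### Pairwise differences of winners -/

namespace MixedAuction

/-- The set of winners depends on the profile only through the order of its entries. -/
theorem wins_iff_card_le {n k : ℕ} (hkn : k < n) (b : Fin n → ℝ) (i : Fin n) :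
    Wins k b i ↔ (Finset.univ.filter fun j => b i ≤ b j).card ≤ k := by
  constructor
  · intro h
    by_contra! hlt
    exact not_le.2 h (le_kthHighest (Nat.succ_pos k) hlt)
  · intro h
    set L := Finset.univ.filter fun j => b j < b i with hL
    have hex : ∀ y, k + 1 ≤ (Finset.univ.filter fun j => y ≤ b j).card → ∃ l ∈ L, y ≤ b l := by
      intro y hy
      obtain ⟨l, hl, hl'⟩ := Finset.exists_mem_notMem_of_card_lt_card
        (lt_of_le_of_lt h (Nat.lt_of_succ_le hy))
      refine ⟨l, ?_, (Finset.mem_filter.1 hl).2⟩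
      simpa [hL] using hl'
    obtain ⟨y₀, hy₀⟩ : ∃ y, k + 1 ≤ (Finset.univ.filter fun j => y ≤ b j).card := by
      obtain ⟨y, hy⟩ := (Set.finite_range b).bddBelow
      refine ⟨y, ?_⟩
      rw [Finset.filter_true_of_mem fun j _ => hy ⟨j, rfl⟩, Finset.card_univ, Fintype.card_fin]
      exact hkn
    obtain ⟨l₀, hl₀, -⟩ := hex y₀ hy₀
    obtain ⟨m, hm, hmax⟩ := L.exists_max_image b ⟨l₀, hl₀⟩
    refine lt_of_le_of_lt (csSup_le ⟨y₀, hy₀⟩ fun y hy => ?_) (Finset.mem_filter.1 hm).2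
    obtain ⟨l, hl, hyl⟩ := hex y hy
    exact hyl.trans (hmax l hl)

theorem wins_comp_iff {n k : ℕ} (hkn : k < n) {I : Set ℝ} {β : ℝ → ℝ} (hβ : StrictMonoOn β I)
    {s : Fin n → ℝ} (hs : ∀ l, s l ∈ I) (i : Fin n) :
    Wins k (fun j => β (s j)) i ↔ Wins k s i := by
  rw [wins_iff_card_le hkn, wins_iff_card_le hkn]
  simp only [hβ.le_iff_le (hs _) (hs _)]

/-- The uniform part of the price cancels in pairwise differences. -/
theorem exPostUtility_sub {n k : ℕ} (hkn : k < n) {I : Set ℝ} {β : ℝ → ℝ}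
    (hβ : StrictMonoOn β I) {s : Fin n → ℝ} (hs : ∀ l, s l ∈ I) (c δ : ℝ) {i j : Fin n}
    (hi : Wins k s i) (hj : Wins k s j) :
    exPostUtility k c δ β s i - exPostUtility k c δ β s j =
      (1 - c) * (s i - s j) - δ * (β (s i) - β (s j)) := by
  have hi' := (wins_comp_iff hkn hβ hs i).2 hi
  have hj' := (wins_comp_iff hkn hβ hs j).2 hj
  simp only [exPostUtility, payoff, price, if_pos hi', if_pos hj', value]
  ring

theorem exists_two_winners {n k : ℕ} (hk : 2 ≤ k) (hkn : k < n) {s : Fin n → ℝ}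
    (hs : Function.Injective s) : ∃ i j, i ≠ j ∧ Wins k s i ∧ Wins k s j := by
  obtain ⟨i, -, hi⟩ := Finset.univ.exists_max_image s (⟨⟨0, by omega⟩, Finset.mem_univ _⟩)
  have : Nontrivial (Fin n) := Fin.nontrivial_iff_two_le.2 (by omega)
  obtain ⟨j₀, hj₀⟩ := exists_ne i
  obtain ⟨j, hj, hjmax⟩ := (Finset.univ.erase i).exists_max_image s ⟨j₀, by simp [hj₀]⟩
  have hji := Finset.ne_of_mem_erase hj
  refine ⟨i, j, hji.symm, (wins_iff_card_le hkn s i).2 ?_, (wins_iff_card_le hkn s j).2 ?_⟩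
  · refine (Finset.card_le_card (t := {i}) fun l hl => ?_).trans (by simp; omega)
    have := (Finset.mem_filter.1 hl).2
    exact Finset.mem_singleton.2 (hs (le_antisymm (hi l (Finset.mem_univ l)) this))
  · refine (Finset.card_le_card (t := {i, j}) fun l hl => ?_).trans
      (Finset.card_le_two.trans hk)
    have := (Finset.mem_filter.1 hl).2
    rw [Finset.mem_insert, Finset.mem_singleton]
    by_cases hli : l = i
    · exact Or.inl hli
    · exact Or.inr (hs (le_antisymm (hjmax l (by simp [hli])) this))

/-- Since `β' ≤ 1` and `δ₂ ≤ κ`, both differences keep the sign of `x - y`; the one with more weight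
on the own bid is reduced by a strictly larger amount. -/
theorem IsBidProblem.abs_spread_lt {I : Set ℝ} {g V : ℝ → ℝ} (H : IsBidProblem I g V)
    {κ δ₁ δ₂ : ℝ} (h1 : 0 ≤ δ₁) (h12 : δ₁ < δ₂) (h2 : δ₂ ≤ κ) {β₁ β₂ : ℝ → ℝ}
    (hβ₁ : StrictMonoOn β₁ I) (h01 : ∀ x ∈ I, 0 ≤ β₁ x) (hs₁ : SolvesBidEquation I g V δ₁ β₁)
    (hβ₂ : StrictMonoOn β₂ I) (h02 : ∀ x ∈ I, 0 ≤ β₂ x) (hs₂ : SolvesBidEquation I g V δ₂ β₂)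
    {x y : ℝ} (hx : x ∈ I) (hy : y ∈ I) (hxy : x ≠ y) :
    |κ * (x - y) - δ₂ * (β₂ x - β₂ y)| < |κ * (x - y) - δ₁ * (β₁ x - β₁ y)| := by
  -- both sides are symmetric in `x` and `y`
  wlog h : y < x generalizing x y
  · have := this hy hx hxy.symm (lt_of_le_of_ne (not_lt.1 h) hxy)
    rw [← abs_neg, ← abs_neg (κ * (x - y) - δ₁ * (β₁ x - β₁ y))]
    convert this using 2 <;> ring
  have e1 := H.mul_bid_sub_lt h1 h12 hβ₁.monotoneOn h01 hs₁ hβ₂ h02 hs₂ hy hx h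
  have hδ₂ : 0 < δ₂ := h1.trans_lt h12
  have e2 := mul_le_mul_of_nonneg_left
    (H.bid_sub_le hδ₂ hβ₂.monotoneOn h02 hs₂ hy hx h.le) hδ₂.le
  have e3 := mul_le_mul_of_nonneg_right h2 (sub_pos.2 h).le
  rw [abs_of_nonneg (by linarith), abs_of_nonneg (by linarith)]
  linarith

section Setup

variable {n k : ℕ} {μ : Measure ℝ} [IsProbabilityMeasure μ] {sbar : EReal} {f : ℝ → ℝ}

/-- Equilibria are exactly the increasing nonnegative solutions of the integrated first-order
condition. -/
theorem isEquilibrium_iff (hk : 2 ≤ k) (hkn : k < n) {c : ℝ} (hc0 : 0 ≤ c) (hc1 : c ≤ 1)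
    (hf : Measurable f)
    (hμ : μ = volume.withDensity fun x => ENNReal.ofReal ((openSupport sbar).indicator f x))
    (hsupp : μ (openSupport sbar)ᶜ = 0)
    (hpos : ∀ x ∈ openSupport sbar, 0 < f x) (hint : Integrable (fun x : ℝ => x) μ)
    (hlog : ConcaveOn ℝ (openSupport sbar) fun x => Real.log (f x))
    {δ : ℝ} (hδ : 0 ≤ δ) {β : ℝ → ℝ} :
    IsEquilibrium n k μ sbar c δ β ↔ (∀ x ∈ openSupport sbar, 0 ≤ β x) ∧
      StrictMonoOn β (openSupport sbar) ∧ SolvesBidEquation (openSupport sbar)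
        (fun t => winWeight n k μ t * (openSupport sbar).indicator f t) (tieValue n k μ c) δ β := by
  have H := isBidProblem hk hkn hc0 hc1 hf hμ hpos hint hlog
  have hα := (ownSignalWeight_pos (by omega : 0 < n) hc0 hc1).le
  have hg : ∀ t, t ∉ openSupport sbar →
      winWeight n k μ t * (openSupport sbar).indicator f t = 0 := fun t ht => by
    rw [Set.indicator_of_notMem ht, mul_zero]
  constructor
  · rintro ⟨h0, hβ, hopt⟩
    refine ⟨h0, hβ, H.solves_of_optimal hg hα hβ h0 fun x hx z hz => ?_⟩
    have hU := fun a => (interimUtility_eq_reducedUtility hk hkn hf hμ hsupp hpos hint hβ h0 c δ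
      ⟨0, by omega⟩ x a).2
    have := hopt ⟨0, by omega⟩ x hx (β z) (h0 z hz)
    rw [hU, hU] at this
    exact le_of_mul_le_mul_left this
      (by exact_mod_cast (rankings_nonempty hk hkn _).card_pos)
  · rintro ⟨h0, hβ, hs⟩
    refine ⟨h0, hβ, fun i x hx a _ => ?_⟩
    have hU := fun a => interimUtility_eq_reducedUtility hk hkn hf hμ hsupp hpos hint hβ h0 c δ
      i x a
    rw [(hU a).2, (hU (β x)).2]
    exact mul_le_mul_of_nonneg_left (H.optimal_of_solves hg hα hδ hβ h0 hs hx (hU a).1)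
      (Nat.cast_nonneg _)

end Setup
end MixedAuction

theorem mainTheorem3 (n k : ℕ) (hk : 2 ≤ k) (hkn : k < n)
    (c : ℝ) (hc0 : 0 ≤ c) (hc1 : c ≤ 1)
    (sbar : EReal) (f : ℝ → ℝ) (hf : Measurable f)
    (μ : MeasureTheory.Measure ℝ) [MeasureTheory.IsProbabilityMeasure μ]
    (hμ : μ = MeasureTheory.volume.withDensity fun x => ENNReal.ofReal (f x))
    (hsupp : μ (MixedAuction.openSupport sbar)ᶜ = 0)
    (hpos : ∀ x ∈ MixedAuction.openSupport sbar, 0 < f x)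
    (hmom : MeasureTheory.Integrable (fun x : ℝ => x ^ 2) μ)
    (hlog : ConcaveOn ℝ (MixedAuction.openSupport sbar) fun x => Real.log (f x)) :
    (∀ δ ∈ Set.Icc 0 (1 - c), ∃ β : ℝ → ℝ, MixedAuction.IsEquilibrium n k μ sbar c δ β) ∧
    (∀ δ ∈ Set.Ico 0 (1 - c), ∀ β βstar : ℝ → ℝ,
      MixedAuction.IsEquilibrium n k μ sbar c δ β →
      MixedAuction.IsEquilibrium n k μ sbar c (1 - c) βstar →
      MixedAuction.DominatesInPairwiseDifferences (n := n) μ k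
        (MixedAuction.exPostUtility k c (1 - c) βstar)
        (MixedAuction.exPostUtility k c δ β)) ∧
    (∀ β : ℝ → ℝ → ℝ,
      (∀ δ ∈ Set.Icc 0 (1 - c), MixedAuction.IsEquilibrium n k μ sbar c δ (β δ)) →
      ∀ᵐ s ∂(MeasureTheory.Measure.pi fun _ : Fin n => μ), ∀ i j : Fin n,
        MixedAuction.Wins k s i → MixedAuction.Wins k s j →
        AntitoneOn (fun δ => |MixedAuction.exPostUtility k c δ (β δ) s i -
          MixedAuction.exPostUtility k c δ (β δ) s j|) (Set.Icc 0 (1 - c))) := by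
  have hμ' := MixedAuction.eq_withDensity_indicator hf hμ hsupp
  -- the mean exists, as `|x| ≤ 1 + x ^ 2`
  have hint : Integrable (fun x : ℝ => x) μ := by
    refine ((integrable_const (1 : ℝ)).add hmom).mono' measurable_id.aestronglyMeasurable
      (Filter.Eventually.of_forall fun x => ?_)
    rw [Real.norm_eq_abs, Pi.add_apply, abs_le]
    constructor <;> nlinarith [sq_nonneg (x - 1), sq_nonneg (x + 1)]
  have H := MixedAuction.isBidProblem hk hkn hc0 hc1 hf hμ' hpos hint hlog
  have heq := fun {δ : ℝ} (hδ : 0 ≤ δ) {β : ℝ → ℝ} =>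
    MixedAuction.isEquilibrium_iff hk hkn hc0 hc1 hf hμ' hsupp hpos hint hlog hδ (β := β)
  have hnull : NullSingletonClass μ := by rw [hμ]; infer_instance
  have hsI : ∀ᵐ s ∂(Measure.pi fun _ : Fin n => μ), ∀ l, s l ∈ MixedAuction.openSupport sbar :=
    ae_all_iff.2 fun l => (Measure.quasiMeasurePreserving_eval (fun _ : Fin n => μ) l).ae
      (by rw [ae_iff]; exact hsupp)
  refine ⟨fun δ hδ => ?_, fun δ hδ β βstar hβ hstar => ?_, fun β hβ => ?_⟩
  · obtain ⟨β, hβ⟩ := H.exists_solution hδ.1 (hδ.2.trans (by linarith))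
    exact ⟨β, (heq hδ.1).2 hβ⟩
  · obtain ⟨a1, a2, a3⟩ := (heq hδ.1).1 hβ
    obtain ⟨b1, b2, b3⟩ := (heq (hδ.1.trans hδ.2.le)).1 hstar
    filter_upwards [hsI, MixedAuction.ae_injective] with s hs hinj
    have hlt : ∀ i j, i ≠ j → MixedAuction.Wins k s i → MixedAuction.Wins k s j →
        |MixedAuction.exPostUtility k c (1 - c) βstar s i -
          MixedAuction.exPostUtility k c (1 - c) βstar s j| <
        |MixedAuction.exPostUtility k c δ β s i - MixedAuction.exPostUtility k c δ β s j| := by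
      intro i j hij hi hj
      rw [MixedAuction.exPostUtility_sub hkn b2 hs c _ hi hj,
        MixedAuction.exPostUtility_sub hkn a2 hs c _ hi hj]
      exact H.abs_spread_lt hδ.1 hδ.2 le_rfl a2 a1 a3 b2 b1 b3 (hs i) (hs j) (hinj.ne hij)
    constructor
    · intro i j hi hj
      rcases eq_or_ne i j with rfl | hij
      · simp
      · exact (hlt i j hij hi hj).le
    · obtain ⟨i, j, hij, hi, hj⟩ := MixedAuction.exists_two_winners hk hkn hinj
      exact ⟨i, j, hi, hj, hlt i j hij hi hj⟩
  · filter_upwards [hsI, MixedAuction.ae_injective] with s hs hinj i j hi hj δ₁ h1 δ₂ h2 h12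
    rcases h12.eq_or_lt with rfl | h12
    · exact le_rfl
    rcases eq_or_ne i j with rfl | hij
    · simp
    obtain ⟨a1, a2, a3⟩ := (heq h1.1).1 (hβ δ₁ h1)
    obtain ⟨b1, b2, b3⟩ := (heq h2.1).1 (hβ δ₂ h2)
    simp only
    rw [MixedAuction.exPostUtility_sub hkn b2 hs c _ hi hj,
      MixedAuction.exPostUtility_sub hkn a2 hs c _ hi hj]
    exact (H.abs_spread_lt h1.1 h12 h2.2 a2 a1 a3 b2 b1 b3 (hs i) (hs j) (hinj.ne hij)).le
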